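/- **Games.** An entangled game $G=(I,O,V,p)$ consists of finite input and output sets $I,O$, a predicate $V(a,b|x,y)\in\{0,1\}$ ($a,b\in O$, $x,y\in I$) and a probability distribution $p$ on $I^2$. For unit vectors $|\phi_{xy}\rangle\in A\otimes B$ ($A$, $B$ finite-dimensional complex Hilbert spaces) and local measurements (POVMs) $A^x=\{A^x_a\}_{a\in O}$ on $A$ and $B^y=\{B^y_b\}_{b\in O}$ on $B$, the winning probability is $$\sum_{x,y,a,b}p_{xy}V(a,b|x,y)\langle\phi_{xy}|A^x_a\otimes B^y_b|\phi_{xy}\rangle .$$ The entangled value $\omega^*(G)$ is its supremum over all finite-dimensional $A,B$, all unit vectors $|\phi\rangle=|\phi_{xy}\rangle$ not depending on $x,y$, and all measurements. For an advice state $\rho=\sum_{xy}p_{xy}|x\rangle\langle x|\otimes|\phi_{xy}\rangle\langle\phi_{xy}|\otimes|y\rangle\langle y|$, the value $\omega^*(G|\rho)$ is the supremum over all measurements, with the $|\phi_{xy}\rangle$ fixed. **Superposed information cost.** Let $p_{x\cdot}=\sum_yp_{xy}$, $p_{\cdot y}=\sum_xp_{xy}$, let $|L^B_x\rangle=\frac1{\sqrt{p_{x\cdot}}}\sum_y\sqrt{p_{xy}}|\phi_{xy}\rangle|y\rangle$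 and $|L^A_y\rangle=\frac1{\sqrt{p_{\cdot y}}}\sum_x\sqrt{p_{xy}}|x\rangle|\phi_{xy}\rangle$ (terms of probability $0$ are omitted), and let $$\sigma^A=\sum_yp_{\cdot y}|L^A_y\rangle\langle L^A_y|_{XAB}\otimes|y\rangle\langle y|_Y,\qquad \sigma^B=\sum_xp_{x\cdot}|x\rangle\langle x|_X\otimes|L^B_x\rangle\langle L^B_x|_{ABY}.$$ Put $SIC(\{|\phi_{xy}\rangle,p_{xy}\})=I(Y:XA)_{\sigma^A}+I(X:BY)_{\sigma^B}$, where $I(M:N)=H(M)+H(N)-H(MN)$ is the quantum mutual information of the reduced state on $MN$ and $H(\rho)=-\mathrm{tr}(\rho\log_2\rho)$. For a state $\rho$, $SIC(\rho)$ is the infimum of $SIC(\{|\phi_{xy}\rangle,p_{xy}\})$ over all families of unit vectors and probability distributions with $\rho=\sum_{xy}p_{xy}|x\rangle\langle x|\otimes|\phi_{xy}\rangle\langle\phi_{xy}|\otimes|y\rangle\langle y|$. **Theorem 3.** There are universal constants $c_0>0$ and $c>0$ such that the following holds. Let $G=(I=[k],O,V,\mathrm{Unif.})$ be a game on the uniform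 distribution $p_{xy}=1/k^2$ with $\omega^*(G)=1-\varepsilon$, let $G'=(I=[k],O,V,p)$ be the same game under a distribution $p$ with $\frac12\sum_{x,y}|p_{xy}-\frac1{k^2}|\le c_0\varepsilon$, and let $\rho=\sum_{xy}p_{xy}|x\rangle\langle x|\otimes|\phi_{xy}\rangle\langle\phi_{xy}|\otimes|y\rangle\langle y|$ be a state with $\omega^*(G'|\rho)\ge1-\frac{\varepsilon}{4}$. Then $SIC(\rho)\ge c\,\varepsilon$. -/

import Mathlib

open scoped Kronecker ComplexOrder

noncomputable section

namespace EntangledGames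

/-! ### Entropy and mutual information of finite-dimensional states -/

/-- Von Neumann entropy `H(ρ) = -tr(ρ log ρ)`, with logarithm to base 2 (the functional calculus
uses `Real.logb 2 0 = 0`, so `0 log 0 = 0`). -/
def entropy {m : Type*} [Fintype m] [DecidableEq m] (ρ : Matrix m m ℂ) : ℝ :=
  -((ρ * cfc (Real.logb 2) ρ).trace).re

/-- Partial trace over the left tensor factor. -/
def traceLeft {m n : Type*} [Fintype m] (ρ : Matrix (m × n) (m × n) ℂ) : Matrix n n ℂ :=
  Matrix.of fun j j' => ∑ i, ρ (i, j) (i, j')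

/-- Partial trace over the right tensor factor. -/
def traceRight {m n : Type*} [Fintype n] (ρ : Matrix (m × n) (m × n) ℂ) : Matrix m m ℂ :=
  Matrix.of fun i i' => ∑ j, ρ (i, j) (i', j)

/-- Mutual information `I(M:N)_ρ = H(M)_ρ + H(N)_ρ - H(MN)_ρ` of a state on `M ⊗ N`. -/
def mutualInfo {m n : Type*} [Fintype m] [DecidableEq m] [Fintype n] [DecidableEq n]
    (ρ : Matrix (m × n) (m × n) ℂ) : ℝ :=
  entropy (traceRight ρ) + entropy (traceLeft ρ) - entropy ρ

/-- The rank-one operator `|v⟩⟨v|`. -/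
def ketbra {m : Type*} (v : m → ℂ) : Matrix m m ℂ :=
  Matrix.vecMulVec v (star v)

/-- The operator `|x⟩⟨x|` for a computational basis vector. -/
def basisProj {m : Type*} [DecidableEq m] (x : m) : Matrix m m ℂ :=
  ketbra (Pi.single x 1)

/-! ### Games and their entangled values -/

/-- A two-player game with input set `I` and output set `O` for each player, acceptance
function `V a b x y = V(a,b|x,y)` and input distribution `p`. -/
structure EntangledGame (I O : Type*) [Fintype I] where
  V : O → O → I → I → Bool
  p : I → I → ℝ
  p_nonneg : ∀ x y, 0 ≤ p x y
  p_sum : ∑ x, ∑ y, p x y = 1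

/-- The input distribution is uniform on pairs of inputs. -/
def EntangledGame.IsUniform {k : ℕ} {O : Type*} (G : EntangledGame (Fin k) O) : Prop :=
  ∀ x y, G.p x y = 1 / (k : ℝ) ^ 2

/-- A quantum measurement (POVM) with outcomes in `O` on the space `ℂ^d`. -/
structure Measurement (O d : Type*) [Fintype O] [Fintype d] [DecidableEq d] where
  op : O → Matrix d d ℂ
  posSemidef : ∀ a, (op a).PosSemidef
  sum_eq_one : ∑ a, op a = 1

section

variable {I O α β : Type*} [Fintype I] [Fintype O]
  [Fintype α] [DecidableEq α] [Fintype β] [DecidableEq β]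

/-- The winning probability
`∑ p(x,y) V(a,b|x,y) ⟨φ_{xy}| A^x_a ⊗ B^y_b |φ_{xy}⟩` when on inputs `x, y` the players share
`φ x y` and measure with `A x` and `B y`. -/
def winProb (G : EntangledGame I O) (φ : I → I → EuclideanSpace ℂ (α × β))
    (A : I → Measurement O α) (B : I → Measurement O β) : ℝ :=
  ∑ x, ∑ y, ∑ a, ∑ b, G.p x y * (if G.V a b x y then 1 else 0) *
    (star (φ x y).ofLp ⬝ᵥ (((A x).op a ⊗ₖ (B y).op b).mulVec (φ x y).ofLp)).re

/-- The entangled value `ω*(G)`: the supremum over all finite-dimensional shared pure states,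
which do not depend on the inputs, and all local measurements. -/
def entangledValue (G : EntangledGame I O) : ℝ :=
  sSup {w | ∃ (m n : ℕ) (ψ : EuclideanSpace ℂ (Fin m × Fin n))
    (A : I → Measurement O (Fin m)) (B : I → Measurement O (Fin n)),
    ‖ψ‖ = 1 ∧ w = winProb G (fun _ _ => ψ) A B}

/-- The entangled value `ω*(G|ρ)` of `G` when the players share the advice state
`ρ = ∑ p(x,y) |x⟩⟨x| ⊗ |φ_{xy}⟩⟨φ_{xy}| ⊗ |y⟩⟨y|`. -/
def adviceValue (G : EntangledGame I O) (φ : I → I → EuclideanSpace ℂ (α × β)) : ℝ :=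
  sSup {w | ∃ (A : I → Measurement O α) (B : I → Measurement O β), w = winProb G φ A B}

end

/-! ### Superposed information cost -/

section

variable {I α β : Type*} [Fintype I] [DecidableEq I]
  [Fintype α] [DecidableEq α] [Fintype β] [DecidableEq β]

/-- `ρ = ∑ p(x,y) |x⟩⟨x| ⊗ |φ_{xy}⟩⟨φ_{xy}| ⊗ |y⟩⟨y|`. -/
def adviceState (p : I → I → ℝ) (φ : I → I → EuclideanSpace ℂ (α × β)) :
    Matrix ((I × (α × β)) × I) ((I × (α × β)) × I) ℂ :=
  ∑ x, ∑ y, (p x y : ℂ) • ((basisProj x ⊗ₖ ketbra (φ x y).ofLp) ⊗ₖ basisProj y)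

/-- `|L^A_y⟩ = (1/√p(·y)) ∑_x √p(xy) |x⟩|φ_{xy}⟩` on `XAB`. -/
def ketLA (p : I → I → ℝ) (φ : I → I → EuclideanSpace ℂ (α × β)) (y : I) :
    I × (α × β) → ℂ :=
  fun i => ((1 / √(∑ x, p x y) * √(p i.1 y) : ℝ) : ℂ) * φ i.1 y i.2

/-- `|L^B_x⟩ = (1/√p(x·)) ∑_y √p(xy) |φ_{xy}⟩|y⟩` on `ABY`. -/
def ketLB (p : I → I → ℝ) (φ : I → I → EuclideanSpace ℂ (α × β)) (x : I) :
    (α × β) × I → ℂ :=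
  fun i => ((1 / √(∑ y, p x y) * √(p x i.2) : ℝ) : ℂ) * φ x i.2 i.1

/-- `σ^A = ∑_y p(·y) |L^A_y⟩⟨L^A_y| ⊗ |y⟩⟨y|` on `XAB ⊗ Y`. -/
def sigmaA (p : I → I → ℝ) (φ : I → I → EuclideanSpace ℂ (α × β)) :
    Matrix ((I × (α × β)) × I) ((I × (α × β)) × I) ℂ :=
  ∑ y, ((∑ x, p x y : ℝ) : ℂ) • (ketbra (ketLA p φ y) ⊗ₖ basisProj y)

/-- `σ^B = ∑_x p(x·) |x⟩⟨x| ⊗ |L^B_x⟩⟨L^B_x|` on `X ⊗ ABY`. -/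
def sigmaB (p : I → I → ℝ) (φ : I → I → EuclideanSpace ℂ (α × β)) :
    Matrix (I × ((α × β) × I)) (I × ((α × β) × I)) ℂ :=
  ∑ x, ((∑ y, p x y : ℝ) : ℂ) • (basisProj x ⊗ₖ ketbra (ketLB p φ x))

/-- Partial trace over register `B` of a state on `XABY`; the result is on `XA ⊗ Y`. -/
def traceB (σ : Matrix ((I × (α × β)) × I) ((I × (α × β)) × I) ℂ) :
    Matrix ((I × α) × I) ((I × α) × I) ℂ :=
  Matrix.of fun i j => ∑ b, σ ((i.1.1, (i.1.2, b)), i.2) ((j.1.1, (j.1.2, b)), j.2)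

/-- Partial trace over register `A` of a state on `XABY`; the result is on `X ⊗ BY`. -/
def traceA (σ : Matrix (I × ((α × β) × I)) (I × ((α × β) × I)) ℂ) :
    Matrix (I × (β × I)) (I × (β × I)) ℂ :=
  Matrix.of fun i j => ∑ a, σ (i.1, ((a, i.2.1), i.2.2)) (j.1, ((a, j.2.1), j.2.2))

/-- The superposed information cost `I(Y:XA)_{σ^A} + I(X:BY)_{σ^B}` of a family of states and a
distribution. -/
def sicFamily (p : I → I → ℝ) (φ : I → I → EuclideanSpace ℂ (α × β)) : ℝ :=
  mutualInfo (traceB (sigmaA p φ)) + mutualInfo (traceA (sigmaB p φ))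

/-- The superposed information cost of a state `ρ`: the infimum over all families of unit vectors
and probability distributions that represent `ρ`. -/
def sic (ρ : Matrix ((I × (α × β)) × I) ((I × (α × β)) × I) ℂ) : ℝ :=
  sInf {s | ∃ (p : I → I → ℝ) (φ : I → I → EuclideanSpace ℂ (α × β)),
    (∀ x y, 0 ≤ p x y) ∧ ∑ x, ∑ y, p x y = 1 ∧ (∀ x y, ‖φ x y‖ = 1) ∧
    adviceState p φ = ρ ∧ s = sicFamily p φ}

end

end EntangledGames

end

/-! After tracing out `B`, `σ^A` is classical on `Y`, with blocks `R_y = M_y M_yᴴ`, where `M_y` is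
the matrix from `B` to `XA` with entries `√p(x,y) φ_{xy}`. So `I(Y:XA)` measures how far the
normalized blocks are from their mean `R`. It bounds, up to a factor `log 2`, the sum over `y` of
the squared Frobenius distances between `√R_y` and `√p(·y) √R` (`exists_sqrt_hsq_le_mutualInfo`).
Since `M_y` and `√R_y` have the same Gram matrix, an isometry `E_y` on `B` alone carries one to the
other, as in Uhlmann's theorem. Because `X` is kept in superposition, a single `E_y` serves all `x`:
on average `(1 ⊗ E_y) φ_{xy}` nearly depends on `x` only. Symmetrically, `I(X:BY)` gives isometries
`F_x` on `A` with `(F_x ⊗ 1) φ_{xy}` nearly depending on `y` only.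

Hence `Φ_{xy} = (F_x ⊗ E_y) φ_{xy}` is nearly a function of `x` and nearly a function of `y`, so
under the nearly uniform product distribution it is nearly one constant vector `ψ = Φ_{x₀y₀}`
(`exists_hsq_sub_le_of_near_both`). Without advice the players share `ψ` and use the advice
measurements transported along `F_x` and `E_y`.

Losing probabilities are positive quadratic forms bounded by the squared norm, so replacing `Φ_{xy}`
by `ψ` at most doubles the loss and adds twice the squared distance. All errors are thus linear in
the information cost and in the total variation distance, with no square roots
(`one_sub_entangledValue_le`). If advice brings the loss down to `ε/4` while every strategy without
it loses at least `ε`, the cost must be of order `ε`. -/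

namespace EntangledGames

open Matrix

/-! ### Squared Euclidean norms and isometries -/

/-- The squared Euclidean norm of a family of complex numbers. -/
noncomputable def hsq {ι : Type*} [Fintype ι] (v : ι → ℂ) : ℝ := ∑ i, ‖v i‖ ^ 2

section hsq

variable {ι κ : Type*} [Fintype ι] [Fintype κ]

lemma hsq_nonneg (v : ι → ℂ) : 0 ≤ hsq v := Finset.sum_nonneg fun _ _ => by positivity

lemma hsq_eq_dotProduct (v : ι → ℂ) : (hsq v : ℂ) = star v ⬝ᵥ v := by
  simp only [hsq, dotProduct, Pi.star_apply, RCLike.star_def, Complex.conj_mul']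
  push_cast
  rfl

lemma hsq_eq_norm (v : EuclideanSpace ℂ ι) : hsq v.ofLp = ‖v‖ ^ 2 := by
  rw [EuclideanSpace.norm_sq_eq, hsq]

lemma hsq_smul (c : ℂ) (v : ι → ℂ) : hsq (c • v) = ‖c‖ ^ 2 * hsq v := by
  simp [hsq, Finset.mul_sum, mul_pow]

lemma hsq_add_le (u v : ι → ℂ) : hsq (u + v) ≤ 2 * hsq u + 2 * hsq v := by
  simp only [hsq, Finset.mul_sum, ← Finset.sum_add_distrib]
  refine Finset.sum_le_sum fun i _ => ?_
  have h := norm_add_le (u i) (v i)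
  have h0 := norm_nonneg (u i + v i)
  simp only [Pi.add_apply]
  nlinarith [sq_nonneg (‖u i‖ - ‖v i‖), norm_nonneg (u i), norm_nonneg (v i)]

lemma hsq_sub_comm (u v : ι → ℂ) : hsq (u - v) = hsq (v - u) := by
  simp [hsq, norm_sub_rev]

lemma hsq_mulVec_of_isometry [DecidableEq ι] (E : Matrix κ ι ℂ) (hE : Eᴴ * E = 1) (v : ι → ℂ) :
    hsq (E *ᵥ v) = hsq v := by
  have : (hsq (E *ᵥ v) : ℂ) = hsq v := by
    rw [hsq_eq_dotProduct, hsq_eq_dotProduct, star_mulVec, ← dotProduct_mulVec, mulVec_mulVec, hE,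
      one_mulVec]
  exact_mod_cast this

end hsq

section isometry

variable {n m : Type*} [Fintype n] [Fintype m] [DecidableEq m]

/-- Two matrices with the same Gram matrix `M * Mᴴ` differ by a unitary on the right. -/
lemma exists_unitary_mul_eq [DecidableEq n] (M N : Matrix n m ℂ) (h : M * Mᴴ = N * Nᴴ) :
    ∃ U : Matrix m m ℂ, U * Uᴴ = 1 ∧ M * U = N := by
  let f : EuclideanSpace ℂ n →ₗ[ℂ] EuclideanSpace ℂ m := toEuclideanLin Mᴴ
  let g : EuclideanSpace ℂ n →ₗ[ℂ] EuclideanSpace ℂ m := toEuclideanLin Nᴴ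
  have hnorm : ∀ v, ‖f v‖ = ‖g v‖ := fun v => by
    have key : ∀ K : Matrix n m ℂ, (hsq (toEuclideanLin Kᴴ v).ofLp : ℂ)
        = star v.ofLp ⬝ᵥ ((K * Kᴴ) *ᵥ v.ofLp) := fun K => by
      rw [hsq_eq_dotProduct]
      simp only [toLpLin_apply]
      rw [star_mulVec, conjTranspose_conjTranspose, ← dotProduct_mulVec, mulVec_mulVec]
    have h1 : (hsq (f v).ofLp : ℂ) = hsq (g v).ofLp := by rw [key, key, h]
    have h2 : ‖f v‖ ^ 2 = ‖g v‖ ^ 2 := by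
      rw [← hsq_eq_norm, ← hsq_eq_norm]; exact_mod_cast h1
    exact (sq_eq_sq₀ (norm_nonneg _) (norm_nonneg _)).1 h2
  -- Equal norms make `Nᴴ v ↦ Mᴴ v` a well-defined isometry on the range of `Nᴴ`; being
  -- finite-dimensional, the space lets it extend to a unitary.
  have hker : LinearMap.ker g ≤ LinearMap.ker f := fun v hv => by
    rw [LinearMap.mem_ker] at hv ⊢
    rw [← norm_eq_zero, hnorm, hv, norm_zero]
  let L0 : LinearMap.range g →ₗ[ℂ] EuclideanSpace ℂ m :=
    (LinearMap.ker g).liftQ f hker ∘ₗ (g.quotKerEquivRange.symm : _ →ₗ[ℂ] _)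
  have hL0 : ∀ v, L0 ⟨g v, v, rfl⟩ = f v := fun v => by
    have : g.quotKerEquivRange.symm ⟨g v, v, rfl⟩ = (LinearMap.ker g).mkQ v := by
      rw [LinearEquiv.symm_apply_eq]
      ext1
      simp
    simp [L0, this]
  let L : LinearMap.range g →ₗᵢ[ℂ] EuclideanSpace ℂ m :=
    ⟨L0, by rintro ⟨_, v, rfl⟩; rw [hL0, hnorm]; rfl⟩
  let T := L.extend
  have hT : ∀ v, T (g v) = f v := fun v => by
    have := L.extend_apply ⟨g v, v, rfl⟩
    exact this.trans (hL0 v)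
  let U : Matrix m m ℂ := toEuclideanLin.symm T.toLinearMap
  have hTU : ∀ v : m → ℂ, (T (WithLp.toLp 2 v)).ofLp = U *ᵥ v := fun v => by
    have : toEuclideanLin U = T.toLinearMap := by simp [U]
    rw [← LinearIsometry.coe_toLinearMap, ← this]
    simp
  have hUU : Uᴴ * U = 1 := by
    ext i j
    have h1 := T.inner_map_map (EuclideanSpace.single i 1) (EuclideanSpace.single j 1)
    have h3 : ∀ i, (T (EuclideanSpace.single i 1)).ofLp = fun k => U k i := fun i => by
      have := hTU (Pi.single i 1)
      rw [mulVec_single_one] at this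
      exact this
    simp only [PiLp.inner_apply, h3] at h1
    simp only [mul_apply, conjTranspose_apply]
    calc _ = _ := Finset.sum_congr rfl fun k _ => by
          rw [RCLike.inner_apply, mul_comm]; rfl
      _ = _ := h1
      _ = _ := by
        simp [one_apply, eq_comm]
  have hUN : U * Nᴴ = Mᴴ := by
    ext i j
    have h1 := hT (EuclideanSpace.single j 1)
    have h2 := hTU (Nᴴ *ᵥ Pi.single j 1)
    have h3 : (f (EuclideanSpace.single j 1)).ofLp = Mᴴ *ᵥ Pi.single j 1 := by
      simp [f, toLpLin_apply]
    have h4 : g (EuclideanSpace.single j 1) = WithLp.toLp 2 (Nᴴ *ᵥ Pi.single j 1) := by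
      simp [g, toLpLin_apply]
    rw [h4] at h1
    rw [h1, h3, mulVec_mulVec, mulVec_single_one, mulVec_single_one] at h2
    exact (congrFun h2 i).symm
  refine ⟨U, mul_eq_one_comm.1 hUU, ?_⟩
  have : M = N * Uᴴ := by
    rw [← conjTranspose_conjTranspose M, ← hUN, conjTranspose_mul, conjTranspose_conjTranspose]
  rw [this, Matrix.mul_assoc, hUU, Matrix.mul_one]

/-- Two purifications `M` and `S` of one operator, the second with a purifying space of the
dimension of the operator, differ by an isometry into a larger purifying space. -/
lemma exists_isometry_mul_transpose_eq [DecidableEq n] (M : Matrix n m ℂ) (S : Matrix n n ℂ)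
    (h : M * Mᴴ = S * Sᴴ) :
    ∃ E : Matrix (m ⊕ n) m ℂ, Eᴴ * E = 1 ∧ M * Eᵀ = fromCols 0 S := by
  -- Zero columns give both matrices the width `m ⊕ n`. The rows of `U` that meet `M` are
  -- orthonormal, and their transpose is the isometry.
  obtain ⟨U, hU, hMU⟩ := exists_unitary_mul_eq (fromCols M (0 : Matrix n n ℂ))
    (fromCols (0 : Matrix n m ℂ) S) (by
      simp [conjTranspose_fromCols_eq_fromRows_conjTranspose, fromCols_mul_fromRows, h])
  refine ⟨(of fun i j => U (Sum.inl i) j)ᵀ, ?_, ?_⟩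
  · ext i j
    have := congrFun (congrFun hU (Sum.inl j)) (Sum.inl i)
    simp only [mul_apply, conjTranspose_apply, transpose_apply, of_apply] at this ⊢
    simp only [mul_comm (star _), this, one_apply, Sum.inl.injEq, eq_comm]
  · ext i j
    rw [← hMU]
    simp [mul_apply]

end isometry

/-! ### Entropies -/

section entropy

variable {n m : Type*} [Fintype n] [DecidableEq n] [Fintype m] [DecidableEq m]

lemma entropy_eq_sum_eigenvalues {A : Matrix n n ℂ} (hA : A.IsHermitian) :
    entropy A = -∑ i, hA.eigenvalues i * Real.logb 2 (hA.eigenvalues i) := by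
  have h : A * cfc (Real.logb 2) A = (hA.eigenvectorUnitary : Matrix n n ℂ) *
      diagonal (fun i => ((hA.eigenvalues i * Real.logb 2 (hA.eigenvalues i) : ℝ) : ℂ)) *
        star (hA.eigenvectorUnitary : Matrix n n ℂ) := by
    rw [hA.cfc_eq, IsHermitian.cfc]
    conv_lhs => enter [1]; rw [hA.spectral_theorem]
    rw [← map_mul, diagonal_mul_diagonal, Unitary.conjStarAlgAut_apply]
    simp [Function.comp_def]
  rw [entropy, h, trace_mul_cycle, Unitary.coe_star_mul_self, Matrix.one_mul, trace_diagonal,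
    Complex.re_sum]
  simp only [Complex.ofReal_re]

lemma roots_prod_X_sub_C_apply {l : Type*} [Fintype l] (d : l → ℂ) :
    (∏ i, (Polynomial.X - Polynomial.C (d i))).roots = Multiset.map d Finset.univ.val := by
  have h := Polynomial.roots_multiset_prod_X_sub_C (Multiset.map d Finset.univ.val)
  rwa [Multiset.map_map] at h

-- Comparing roots of the characteristic polynomial as multisets avoids matching the order of
-- `hA.eigenvalues` with that of `a`.
omit [DecidableEq m] in
lemma entropy_eq_of_charpoly {A : Matrix n n ℂ} (hA : A.IsHermitian) (a : m → ℝ)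
    (h : A.charpoly = ∏ i, (Polynomial.X - Polynomial.C (a i : ℂ))) :
    entropy A = -∑ i, a i * Real.logb 2 (a i) := by
  have h1 : Multiset.map (fun i => (hA.eigenvalues i : ℂ)) Finset.univ.val
      = Multiset.map (fun i => (a i : ℂ)) Finset.univ.val := by
    have h2 := hA.charpoly_eq
    rw [h] at h2
    have h3 := congrArg Polynomial.roots h2
    exact ((roots_prod_X_sub_C_apply _).symm.trans h3.symm).trans (roots_prod_X_sub_C_apply _)
  rw [entropy_eq_sum_eigenvalues hA]
  have h4 := congrArg (fun s => (s.map (fun z : ℂ => z.re * Real.logb 2 z.re)).sum) h1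
  simpa [Multiset.map_map, Function.comp_def] using h4

lemma charpoly_conj_diagonal (U : Matrix n n ℂ) (hU : Uᴴ * U = 1) (d : n → ℂ) :
    (U * diagonal d * Uᴴ).charpoly = ∏ i, (Polynomial.X - Polynomial.C (d i)) := by
  rw [charpoly_mul_comm, ← Matrix.mul_assoc, hU, Matrix.one_mul, charpoly_diagonal]

lemma isHermitian_conj_diagonal (U : Matrix n n ℂ) (a : n → ℝ) :
    (U * diagonal (fun i => (a i : ℂ)) * Uᴴ).IsHermitian := by
  refine isHermitian_mul_mul_conjTranspose U ?_
  refine isHermitian_diagonal_of_self_adjoint _ ?_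
  ext i
  simp

lemma entropy_conj_diagonal (U : Matrix n n ℂ) (hU : Uᴴ * U = 1) (a : n → ℝ) :
    entropy (U * diagonal (fun i => (a i : ℂ)) * Uᴴ) = -∑ i, a i * Real.logb 2 (a i) :=
  entropy_eq_of_charpoly (isHermitian_conj_diagonal U a) a (charpoly_conj_diagonal U hU _)

lemma entropy_diagonal (a : n → ℝ) :
    entropy (diagonal (fun i => (a i : ℂ))) = -∑ i, a i * Real.logb 2 (a i) := by
  simpa using entropy_conj_diagonal (1 : Matrix n n ℂ) (by simp) a

lemma entropy_reindex (e : n ≃ m) {A : Matrix n n ℂ} (hA : A.IsHermitian) :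
    entropy (reindex e e A) = entropy A := by
  rw [entropy_eq_sum_eigenvalues hA]
  refine entropy_eq_of_charpoly ?_ _ ?_
  · exact hA.submatrix _
  · rw [charpoly_reindex]
    exact hA.charpoly_eq

lemma entropy_blockDiagonal {o : Type*} [Fintype o] [DecidableEq o] (U : o → Matrix n n ℂ)
    (hU : ∀ y, (U y)ᴴ * U y = 1) (a : o → n → ℝ) :
    entropy (blockDiagonal fun y => U y * diagonal (fun i => (a y i : ℂ)) * (U y)ᴴ)
      = -∑ y, ∑ i, a y i * Real.logb 2 (a y i) := by
  have h : (blockDiagonal fun y => U y * diagonal (fun i => (a y i : ℂ)) * (U y)ᴴ)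
      = blockDiagonal U * diagonal (fun i : n × o => (a i.2 i.1 : ℂ)) * (blockDiagonal U)ᴴ := by
    rw [blockDiagonal_conjTranspose, ← blockDiagonal_diagonal fun y i => (a y i : ℂ),
      ← blockDiagonal_mul, ← blockDiagonal_mul]
  rw [h]
  refine (entropy_conj_diagonal _ ?_ fun i : n × o => a i.2 i.1).trans ?_
  · rw [blockDiagonal_conjTranspose, ← blockDiagonal_mul]
    simp only [hU]
    exact blockDiagonal_one
  · rw [Fintype.sum_prod_type_right]

lemma exists_diagonalization {A : Matrix n n ℂ} (hA : A.PosSemidef) :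
    ∃ (U : Matrix n n ℂ) (a : n → ℝ), Uᴴ * U = 1 ∧ (∀ i, 0 ≤ a i) ∧
      A = U * diagonal (fun i => (a i : ℂ)) * Uᴴ := by
  refine ⟨hA.1.eigenvectorUnitary, hA.1.eigenvalues, ?_, hA.eigenvalues_nonneg, ?_⟩
  · exact Unitary.coe_star_mul_self _
  · have := hA.1.spectral_theorem
    rw [Unitary.conjStarAlgAut_apply] at this
    exact this

end entropy

/-! ### A lower bound on the information of a classical-quantum state -/

/-- The scalar inequality behind the comparison of relative entropy and Hellinger distance. -/
lemma sq_sqrt_sub_le {a p r : ℝ} (ha : 0 ≤ a) (hp : 0 ≤ p) (hr : 0 ≤ r)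
    (hap : p = 0 → a = 0) (har : r = 0 → a = 0) :
    (√a - √p * √r) ^ 2
      ≤ a * Real.log a - a * Real.log p - a * Real.log r - a + p * r := by
  rcases ha.eq_or_lt with rfl | ha'
  · simp [mul_pow, Real.sq_sqrt hp, Real.sq_sqrt hr]
  have hp' : 0 < p := hp.lt_of_ne fun h => ha'.ne' (hap h.symm)
  have hr' : 0 < r := hr.lt_of_ne fun h => ha'.ne' (har h.symm)
  -- This is `log t ≤ t - 1` at `t = √(p r / a)`; multiplied by `2a` it yields the square.
  have h1 : Real.log (√p * √r / √a) ≤ √p * √r / √a - 1 :=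
    Real.log_le_sub_one_of_pos (by positivity)
  rw [Real.log_div (by positivity) (by positivity), Real.log_mul (by positivity) (by positivity),
    Real.log_sqrt hp, Real.log_sqrt hr, Real.log_sqrt ha] at h1
  have h2 := mul_le_mul_of_nonneg_left h1 ha
  have h3 : a * (√p * √r / √a - 1) = √a * (√p * √r) - a := by
    calc _ = a / √a * (√p * √r) - a := by ring
      _ = _ := by rw [Real.div_sqrt]
  have h4 : (√a - √p * √r) ^ 2 = a - 2 * (√a * (√p * √r)) + p * r := by
    have := Real.sq_sqrt ha
    have := Real.sq_sqrt hp
    have := Real.sq_sqrt hr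
    calc _ = √a ^ 2 - 2 * (√a * (√p * √r)) + √p ^ 2 * √r ^ 2 := by ring
      _ = _ := by simp only [*]
  rw [h4]
  linarith

section core

variable {n o : Type*} [Fintype n] [DecidableEq n] [Fintype o] [DecidableEq o]

omit [Fintype n] [DecidableEq n] in
lemma traceRight_blockDiagonal (R : o → Matrix n n ℂ) :
    traceRight (blockDiagonal R) = ∑ y, R y := by
  ext i j
  simp [traceRight, blockDiagonal_apply, Matrix.sum_apply]

omit [DecidableEq n] [Fintype o] in
lemma traceLeft_blockDiagonal (R : o → Matrix n n ℂ) :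
    traceLeft (blockDiagonal R) = diagonal fun y => (R y).trace := by
  ext i j
  by_cases h : i = j
  · subst h
    simp [traceLeft, blockDiagonal_apply, trace]
  · simp [traceLeft, blockDiagonal_apply, h]

lemma sum_norm_sq_row (W : Matrix n n ℂ) (hW : W * Wᴴ = 1) (i : n) :
    ∑ j, ‖W i j‖ ^ 2 = 1 := by
  have h := congrFun (congrFun hW i) i
  simp only [mul_apply, conjTranspose_apply, RCLike.star_def, Complex.mul_conj', one_apply_eq] at h
  exact_mod_cast h

lemma sum_norm_sq_col (W : Matrix n n ℂ) (hW : Wᴴ * W = 1) (j : n) :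
    ∑ i, ‖W i j‖ ^ 2 = 1 := by
  have h := congrFun (congrFun hW j) j
  simp only [mul_apply, conjTranspose_apply, RCLike.star_def, Complex.conj_mul', one_apply_eq] at h
  exact_mod_cast h

/-- The entries of a matrix as one family, in which `hsq` is the squared Frobenius norm. -/
def entries {l k : Type*} (M : Matrix l k ℂ) : l × k → ℂ := fun i => M i.1 i.2

lemma hsq_entries {l k : Type*} [Fintype l] [Fintype k] (M : Matrix l k ℂ) :
    (hsq (entries M) : ℂ) = (Mᴴ * M).trace := by
  simp only [hsq, entries, Fintype.sum_prod_type, trace, diag_apply, mul_apply,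
    conjTranspose_apply, RCLike.star_def, Complex.conj_mul']
  rw [Finset.sum_comm]
  push_cast
  rfl

lemma hsq_entries_conj (M U V : Matrix n n ℂ) (hU : U * Uᴴ = 1) (hV : V * Vᴴ = 1) :
    hsq (entries (Uᴴ * M * V)) = hsq (entries M) := by
  have : (hsq (entries (Uᴴ * M * V)) : ℂ) = hsq (entries M) := by
    rw [hsq_entries, hsq_entries]
    simp only [conjTranspose_mul, conjTranspose_conjTranspose]
    calc _ = (Vᴴ * (Mᴴ * (U * Uᴴ) * M) * V).trace := by simp only [Matrix.mul_assoc]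
      _ = ((V * Vᴴ) * (Mᴴ * (U * Uᴴ) * M)).trace := by
        rw [trace_mul_comm, ← Matrix.mul_assoc]
      _ = _ := by rw [hU, hV]; simp
  exact_mod_cast this

lemma conj_diagonal_mul_self (U : Matrix n n ℂ) (hU : Uᴴ * U = 1) (a : n → ℝ)
    (ha : ∀ i, 0 ≤ a i) :
    (U * diagonal (fun i => ((√(a i) : ℝ) : ℂ)) * Uᴴ) *
      (U * diagonal (fun i => ((√(a i) : ℝ) : ℂ)) * Uᴴ)ᴴ
      = U * diagonal (fun i => (a i : ℂ)) * Uᴴ := by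
  rw [isHermitian_conj_diagonal U fun i => √(a i)]
  have : (U * diagonal (fun i => ((√(a i) : ℝ) : ℂ)) * Uᴴ) *
      (U * diagonal (fun i => ((√(a i) : ℝ) : ℂ)) * Uᴴ) =
      U * (diagonal (fun i => ((√(a i) : ℝ) : ℂ)) * (Uᴴ * U) *
        diagonal (fun i => ((√(a i) : ℝ) : ℂ))) * Uᴴ := by
    simp only [Matrix.mul_assoc]
  rw [this, hU, Matrix.mul_one, diagonal_mul_diagonal]
  congr 3
  ext i
  rw [← Complex.ofReal_mul, Real.mul_self_sqrt (ha i)]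

lemma trace_conj_diagonal (U : Matrix n n ℂ) (hU : Uᴴ * U = 1) (a : n → ℝ) :
    (U * diagonal (fun i => (a i : ℂ)) * Uᴴ).trace = ((∑ i, a i : ℝ) : ℂ) := by
  rw [trace_mul_cycle, hU, Matrix.one_mul, trace_diagonal]
  push_cast
  rfl

/-- The mutual information of a classical-quantum state dominates the mean squared distance between
the square roots of the conditional states and the square root of their mean. -/
theorem exists_sqrt_hsq_le_mutualInfo (R : o → Matrix n n ℂ) (hR : ∀ y, (R y).PosSemidef)
    (htr : ∑ y, (R y).trace = 1) :
    ∃ (S : o → Matrix n n ℂ) (T : Matrix n n ℂ), (∀ y, S y * (S y)ᴴ = R y) ∧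
      T * Tᴴ = ∑ y, R y ∧
      ∑ y, hsq (entries (S y - ((√(R y).trace.re : ℝ) : ℂ) • T))
        ≤ Real.log 2 * mutualInfo (blockDiagonal R) := by
  choose U a hU ha hRU using fun y => exists_diagonalization (hR y)
  obtain ⟨V, r, hV, hr, hRV⟩ := exists_diagonalization (posSemidef_sum Finset.univ fun y _ => hR y)
  have hU' := fun y => mul_eq_one_comm.1 (hU y)
  have hV' := mul_eq_one_comm.1 hV
  set W : o → Matrix n n ℂ := fun y => (U y)ᴴ * V with hWdef
  have hW1 : ∀ y, W y * (W y)ᴴ = 1 := fun y => by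
    simp only [hWdef, conjTranspose_mul, conjTranspose_conjTranspose]
    rw [Matrix.mul_assoc, ← Matrix.mul_assoc V, hV', Matrix.one_mul, hU]
  have hW2 : ∀ y, (W y)ᴴ * W y = 1 := fun y => mul_eq_one_comm.1 (hW1 y)
  -- Squared overlaps of the eigenbases of `R y` and of the mean form a doubly stochastic matrix.
  -- This makes the problem classical: `w·a` and `w·p·r` are probability distributions on triples
  -- `(y, i, j)`, their relative entropy is the mutual information in nats, and their squared
  -- Hellinger distance is the Frobenius sum.
  set w : o → n → n → ℝ := fun y i j => ‖W y i j‖ ^ 2 with hw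
  have hw0 : ∀ y i j, 0 ≤ w y i j := fun y i j => by positivity
  have hrow : ∀ y i, ∑ j, w y i j = 1 := fun y i => sum_norm_sq_row _ (hW1 y) i
  have hcol : ∀ y j, ∑ i, w y i j = 1 := fun y j => sum_norm_sq_col _ (hW2 y) j
  set p : o → ℝ := fun y => ∑ i, a y i with hp
  have hp0 : ∀ y, 0 ≤ p y := fun y => Finset.sum_nonneg fun i _ => ha y i
  have htrR : ∀ y, (R y).trace = (p y : ℂ) := fun y => by
    rw [hRU y, trace_conj_diagonal _ (hU y)]
  have hp1 : ∑ y, p y = 1 := by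
    simp only [htrR] at htr
    exact_mod_cast htr
  have hr1 : ∑ j, r j = 1 := by
    have h : (∑ y, R y).trace = 1 := by rw [trace_sum, htr]
    rw [hRV, trace_conj_diagonal _ hV] at h
    exact_mod_cast h
  have hmarg : ∀ j, ∑ y, ∑ i, w y i j * a y i = r j := fun j => by
    have h1 : Vᴴ * (∑ y, R y) * V = diagonal fun i => (r i : ℂ) := by
      rw [hRV]
      calc _ = (Vᴴ * V) * diagonal (fun i => (r i : ℂ)) * (Vᴴ * V) := by
            simp only [Matrix.mul_assoc]
        _ = _ := by rw [hV]; simp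
    have h2 : Vᴴ * (∑ y, R y) * V =
        ∑ y, (W y)ᴴ * diagonal (fun i => (a y i : ℂ)) * W y := by
      rw [Finset.mul_sum, Finset.sum_mul]
      refine Finset.sum_congr rfl fun y _ => ?_
      conv_lhs => rw [hRU y]
      simp only [hWdef, conjTranspose_mul, conjTranspose_conjTranspose, Matrix.mul_assoc]
    have h3 := congrFun (congrFun (h2.symm.trans h1) j) j
    have h5 : ∀ y, ((W y)ᴴ * diagonal (fun i => (a y i : ℂ)) * W y) j j
        = ∑ i, star (W y i j) * (a y i : ℂ) * W y i j := fun y => by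
      rw [mul_apply]
      simp only [mul_diagonal, conjTranspose_apply]
    simp only [Matrix.sum_apply, h5, diagonal_apply_eq] at h3
    have h4 : ∀ y i, star (W y i j) * (a y i : ℂ) * W y i j = ((w y i j * a y i : ℝ) : ℂ) := by
      intro y i
      rw [mul_right_comm, RCLike.star_def, Complex.conj_mul']
      simp only [hw]
      push_cast
      rfl
    simp only [h4] at h3
    exact_mod_cast h3
  refine ⟨fun y => U y * diagonal (fun i => ((√(a y i) : ℝ) : ℂ)) * (U y)ᴴ,
    V * diagonal (fun i => ((√(r i) : ℝ) : ℂ)) * Vᴴ, ?_, ?_, ?_⟩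
  · intro y
    rw [conj_diagonal_mul_self _ (hU y) _ (ha y), ← hRU y]
  · rw [conj_diagonal_mul_self _ hV _ hr, ← hRV]
  have hdist : ∀ y, hsq (entries (U y * diagonal (fun i => ((√(a y i) : ℝ) : ℂ)) * (U y)ᴴ
        - ((√(R y).trace.re : ℝ) : ℂ) • (V * diagonal (fun i => ((√(r i) : ℝ) : ℂ)) * Vᴴ)))
      = ∑ i, ∑ j, w y i j * (√(a y i) - √(p y) * √(r j)) ^ 2 := fun y => by
    rw [← hsq_entries_conj _ (U y) V (hU' y) hV', htrR, Complex.ofReal_re]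
    have h1 : (U y)ᴴ * (U y * diagonal (fun i => ((√(a y i) : ℝ) : ℂ)) * (U y)ᴴ
        - ((√(p y) : ℝ) : ℂ) • (V * diagonal (fun i => ((√(r i) : ℝ) : ℂ)) * Vᴴ)) * V
        = diagonal (fun i => ((√(a y i) : ℝ) : ℂ)) * W y
          - ((√(p y) : ℝ) : ℂ) • (W y * diagonal (fun i => ((√(r i) : ℝ) : ℂ))) := by
      rw [Matrix.mul_sub, Matrix.sub_mul, Matrix.mul_smul, Matrix.smul_mul]
      congr 1
      · calc _ = ((U y)ᴴ * U y) * diagonal (fun i => ((√(a y i) : ℝ) : ℂ)) * ((U y)ᴴ * V) := by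
              simp only [Matrix.mul_assoc]
          _ = _ := by rw [hU, Matrix.one_mul]
      · congr 1
        calc _ = ((U y)ᴴ * V) * diagonal (fun i => ((√(r i) : ℝ) : ℂ)) * (Vᴴ * V) := by
              simp only [Matrix.mul_assoc]
          _ = _ := by rw [hV, Matrix.mul_one]
    rw [h1, hsq, Fintype.sum_prod_type]
    refine Finset.sum_congr rfl fun i _ => Finset.sum_congr rfl fun j _ => ?_
    have h2 : (diagonal (fun i => ((√(a y i) : ℝ) : ℂ)) * W y
          - ((√(p y) : ℝ) : ℂ) • (W y * diagonal (fun i => ((√(r i) : ℝ) : ℂ)))) i j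
        = W y i j * ((√(a y i) - √(p y) * √(r j) : ℝ) : ℂ) := by
      simp only [Matrix.sub_apply, diagonal_mul, Matrix.smul_apply, mul_diagonal, smul_eq_mul]
      push_cast
      ring
    simp only [entries, h2, norm_mul, Complex.norm_real, mul_pow, Real.norm_eq_abs, sq_abs, hw]
  have hlog : ∀ t : ℝ, Real.log 2 * Real.logb 2 t = Real.log t := fun t => by
    rw [Real.logb, mul_div_cancel₀]
    exact (Real.log_pos one_lt_two).ne'
  have hinfo : Real.log 2 * mutualInfo (blockDiagonal R)
      = (∑ y, ∑ i, a y i * Real.log (a y i)) - (∑ y, p y * Real.log (p y))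
        - ∑ j, r j * Real.log (r j) := by
    rw [mutualInfo, traceRight_blockDiagonal, traceLeft_blockDiagonal, hRV,
      entropy_conj_diagonal _ hV, funext htrR, entropy_diagonal,
      show R = fun y => U y * diagonal (fun i => (a y i : ℂ)) * (U y)ᴴ from funext hRU,
      entropy_blockDiagonal U hU a]
    have hl : ∀ t : ℝ, t * Real.log t = Real.log 2 * (t * Real.logb 2 t) := fun t => by
      rw [← hlog]
      ring
    simp only [hl, ← Finset.mul_sum]
    ring
  rw [Finset.sum_congr rfl fun y _ => hdist y, hinfo]
  have hpt : ∀ y i j, w y i j * (√(a y i) - √(p y) * √(r j)) ^ 2 ≤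
      w y i j * (a y i * Real.log (a y i)) - (w y i j * a y i) * Real.log (p y)
        - (w y i j * a y i) * Real.log (r j) - w y i j * a y i + w y i j * (p y * r j) := by
    intro y i j
    -- Where the overlap is positive, `r j = 0` forces `a y i = 0` by `hmarg`; this is the support
    -- condition of `sq_sqrt_sub_le`.
    rcases (hw0 y i j).eq_or_lt with h0 | h0
    · simp [← h0]
    have h := mul_le_mul_of_nonneg_left (sq_sqrt_sub_le (ha y i) (hp0 y) (hr j) ?_ ?_) (hw0 y i j)
    · linarith
    · intro h
      exact (Finset.sum_eq_zero_iff_of_nonneg fun i _ => ha y i).1 h i (Finset.mem_univ i)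
    · intro h
      have h1 := hmarg j
      rw [h, Finset.sum_eq_zero_iff_of_nonneg fun y _ =>
        Finset.sum_nonneg fun i _ => mul_nonneg (hw0 y i j) (ha y i)] at h1
      have h2 := h1 y (Finset.mem_univ y)
      rw [Finset.sum_eq_zero_iff_of_nonneg fun i _ => mul_nonneg (hw0 y i j) (ha y i)] at h2
      exact (mul_eq_zero.1 (h2 i (Finset.mem_univ i))).resolve_left h0.ne'
  refine (Finset.sum_le_sum fun y _ => Finset.sum_le_sum fun i _ => Finset.sum_le_sum fun j _ =>
    hpt y i j).trans (le_of_eq ?_)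
  simp only [Finset.sum_add_distrib, Finset.sum_sub_distrib]
  have e1 : ∑ y, ∑ i, ∑ j, w y i j * (a y i * Real.log (a y i))
      = ∑ y, ∑ i, a y i * Real.log (a y i) := by
    simp only [← Finset.sum_mul, hrow, one_mul]
  have e2 : ∑ y, ∑ i, ∑ j, w y i j * a y i * Real.log (p y) = ∑ y, p y * Real.log (p y) := by
    simp only [← Finset.sum_mul, hrow, one_mul, hp]
  have e3 : ∑ y, ∑ i, ∑ j, w y i j * a y i * Real.log (r j) = ∑ j, r j * Real.log (r j) := by
    calc _ = ∑ y, ∑ j, ∑ i, w y i j * a y i * Real.log (r j) :=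
          Finset.sum_congr rfl fun y _ => Finset.sum_comm
      _ = ∑ j, ∑ y, ∑ i, w y i j * a y i * Real.log (r j) := Finset.sum_comm
      _ = _ := by simp only [← Finset.sum_mul, hmarg]
  have e4 : ∑ y, ∑ i, ∑ j, w y i j * a y i = 1 := by
    simp only [← Finset.sum_mul, hrow, one_mul]
    exact hp1
  have e5 : ∑ y, ∑ i, ∑ j, w y i j * (p y * r j) = 1 := by
    calc _ = ∑ y, ∑ j, ∑ i, w y i j * (p y * r j) :=
          Finset.sum_congr rfl fun y _ => Finset.sum_comm
      _ = _ := by simp only [← Finset.sum_mul, hcol, one_mul, ← Finset.mul_sum, hr1, mul_one, hp1]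
  rw [e1, e2, e3, e4, e5]
  ring

end core

/-! ### Local isometries from the superposed information cost -/

section sides

lemma one_kronecker_mulVec {l m n : Type*} [Fintype l] [DecidableEq l] [Fintype n]
    (E : Matrix m n ℂ) (v : l × n → ℂ) (i : l × m) :
    (((1 : Matrix l l ℂ) ⊗ₖ E) *ᵥ v) i = ∑ b, E i.2 b * v (i.1, b) := by
  simp [mulVec, dotProduct, Fintype.sum_prod_type, kroneckerMap_apply, one_apply]

lemma kronecker_one_mulVec {l m n : Type*} [Fintype l] [DecidableEq l] [Fintype n]
    (F : Matrix m n ℂ) (v : n × l → ℂ) (i : m × l) :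
    ((F ⊗ₖ (1 : Matrix l l ℂ)) *ᵥ v) i = ∑ a, F i.1 a * v (a, i.2) := by
  simp [mulVec, dotProduct, Fintype.sum_prod_type_right, kroneckerMap_apply, one_apply]

variable {I α β : Type*} [Fintype I] [DecidableEq I]
  [Fintype α] [DecidableEq α] [Fintype β] [DecidableEq β]

/-- The superposition over `x` of the unnormalized states `√p(x,y) |x⟩|φ_{xy}⟩`, as a matrix from
`B` to `XA`. -/
noncomputable def superposition (p : I → I → ℝ) (φ : I → I → EuclideanSpace ℂ (α × β)) (y : I) :
    Matrix (I × α) β ℂ :=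
  of fun i b => ((√(p i.1 y) : ℝ) : ℂ) * φ i.1 y (i.2, b)

-- The weight `p(·y)` cancels the normalization of `|L^A_y⟩`, and summing over `B` is the matrix
-- product.
omit [Fintype α] [DecidableEq α] [DecidableEq β] in
lemma traceB_sigmaA (p : I → I → ℝ) (φ : I → I → EuclideanSpace ℂ (α × β))
    (hp : ∀ x y, 0 ≤ p x y) :
    traceB (sigmaA p φ)
      = blockDiagonal fun y => superposition p φ y * (superposition p φ y)ᴴ := by
  ext ⟨⟨x, a⟩, y⟩ ⟨⟨x', a'⟩, y'⟩
  have hc : ∀ (x x' y : I), ((∑ z, p z y : ℝ) : ℂ) *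
      (((1 / √(∑ z, p z y) * √(p x y) : ℝ) : ℂ) * ((1 / √(∑ z, p z y) * √(p x' y) : ℝ) : ℂ))
      = ((√(p x y) : ℝ) : ℂ) * ((√(p x' y) : ℝ) : ℂ) := by
    intro x x' y
    norm_cast
    have h0 : 0 ≤ ∑ z, p z y := Finset.sum_nonneg fun z _ => hp z y
    -- If `p(·y) = 0` then every `p(x,y)` vanishes, so the junk value of `1 / √0` is harmless.
    rcases h0.eq_or_lt with h | h
    · have : p x y = 0 :=
        (Finset.sum_eq_zero_iff_of_nonneg fun z _ => hp z y).1 h.symm x (Finset.mem_univ x)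
      simp [this]
    · have h1 := Real.mul_self_sqrt h0
      have h2 : √(∑ z, p z y) ≠ 0 := (Real.sqrt_pos.2 h).ne'
      nth_rewrite 1 [← h1]
      field_simp
  by_cases h : y = y'
  · subst h
    simp only [traceB, of_apply, sigmaA, Matrix.sum_apply, Matrix.smul_apply, kroneckerMap_apply,
      basisProj, ketbra, vecMulVec_apply, Pi.star_apply, Pi.single_apply, blockDiagonal_apply,
      if_true, mul_apply, conjTranspose_apply, superposition, ketLA, smul_eq_mul]
    refine Finset.sum_congr rfl fun b _ => ?_
    rw [Finset.sum_eq_single y]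
    · simp only [if_true, star_one, mul_one, star_mul, RCLike.star_def, Complex.conj_ofReal]
      calc _ = (((∑ z, p z y : ℝ) : ℂ) * (((1 / √(∑ z, p z y) * √(p x y) : ℝ) : ℂ) *
              ((1 / √(∑ z, p z y) * √(p x' y) : ℝ) : ℂ)))
            * (φ x y (a, b) * (starRingEnd ℂ) (φ x' y (a', b))) := by ring
        _ = _ := by rw [hc]; ring
    · intro z _ hz
      simp [Ne.symm hz]
    · simp
  · simp only [traceB, of_apply, sigmaA, Matrix.sum_apply, Matrix.smul_apply, kroneckerMap_apply,
      basisProj, ketbra, vecMulVec_apply, Pi.star_apply, Pi.single_apply, blockDiagonal_apply,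
      if_neg h, smul_eq_mul]
    refine Finset.sum_eq_zero fun b _ => Finset.sum_eq_zero fun z _ => ?_
    by_cases hz : y = z
    · subst hz
      simp [Ne.symm h]
    · simp [hz]

omit [DecidableEq I] [DecidableEq α] [DecidableEq β] in
lemma trace_superposition (p : I → I → ℝ) (φ : I → I → EuclideanSpace ℂ (α × β))
    (hp : ∀ x y, 0 ≤ p x y) (hφ : ∀ x y, ‖φ x y‖ = 1) (y : I) :
    (superposition p φ y * (superposition p φ y)ᴴ).trace = ((∑ x, p x y : ℝ) : ℂ) := by
  simp only [trace, diag_apply, mul_apply, conjTranspose_apply, RCLike.star_def,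
    Complex.mul_conj', superposition, of_apply, Fintype.sum_prod_type, norm_mul,
    Complex.norm_real, Real.norm_eq_abs]
  norm_cast
  refine Finset.sum_congr rfl fun x _ => ?_
  have h := hφ x y
  have h1 := hsq_eq_norm (φ x y)
  rw [h, hsq, Fintype.sum_prod_type] at h1
  simp only [mul_pow, sq_abs, Real.sq_sqrt (hp x y), ← Finset.mul_sum, h1]
  simp

/-- If `I(Y:XA)` is small then `B` can, knowing `y`, rotate the states `φ_{xy}` to vectors which
nearly do not depend on `y`. -/
lemma exists_isometry_right (p : I → I → ℝ) (φ : I → I → EuclideanSpace ℂ (α × β))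
    (hp : ∀ x y, 0 ≤ p x y) (hp1 : ∑ x, ∑ y, p x y = 1) (hφ : ∀ x y, ‖φ x y‖ = 1) :
    ∃ (E : I → Matrix (β ⊕ (I × α)) β ℂ) (s : I → α × (β ⊕ (I × α)) → ℂ),
      (∀ y, (E y)ᴴ * E y = 1) ∧ ∑ x, hsq (s x) = 1 ∧
      ∑ x, ∑ y, hsq (((√(p x y) : ℝ) : ℂ) • (((1 : Matrix α α ℂ) ⊗ₖ E y) *ᵥ (φ x y).ofLp)
        - ((√(∑ z, p z y) : ℝ) : ℂ) • s x) ≤ Real.log 2 * mutualInfo (traceB (sigmaA p φ)) := by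
  have htr := trace_superposition p φ hp hφ
  have htr1 : ∑ y, (superposition p φ y * (superposition p φ y)ᴴ).trace = 1 := by
    rw [Finset.sum_congr rfl fun y _ => htr y]
    rw [Finset.sum_comm] at hp1
    exact_mod_cast hp1
  obtain ⟨S, T, hS, hT, hle⟩ := exists_sqrt_hsq_le_mutualInfo
    (fun y => superposition p φ y * (superposition p φ y)ᴴ)
    (fun y => posSemidef_self_mul_conjTranspose _) htr1
  choose E hE hES using fun y => exists_isometry_mul_transpose_eq (superposition p φ y) (S y)
    (hS y).symm
  -- `s x` is the block of rows `x` of the padded square root of the mean state, hence free of `y`.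
  refine ⟨E, fun x i => fromCols (0 : Matrix (I × α) β ℂ) T (x, i.1) i.2, hE, ?_, ?_⟩
  · have h1 : (hsq (entries T) : ℂ) = 1 := by
      rw [hsq_entries, trace_mul_comm, hT, trace_sum, htr1]
    have h2 : hsq (entries T) = 1 := by exact_mod_cast h1
    rw [← h2]
    simp [hsq, entries, Fintype.sum_prod_type, Fintype.sum_sum_type]
  rw [traceB_sigmaA p φ hp]
  refine le_trans (le_of_eq ?_) hle
  rw [Finset.sum_comm]
  refine Finset.sum_congr rfl fun y _ => ?_
  -- Multiplying by `(E y)ᵀ` on the right applies `E y` to the register `B` of every row block `x`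
  -- at once.
  have hrow : ∀ x a c, (((√(p x y) : ℝ) : ℂ) • (((1 : Matrix α α ℂ) ⊗ₖ E y) *ᵥ (φ x y).ofLp)) (a, c)
      = fromCols (0 : Matrix (I × α) β ℂ) (S y) (x, a) c := fun x a c => by
    rw [← hES y, Pi.smul_apply, one_kronecker_mulVec, mul_apply, smul_eq_mul, Finset.mul_sum]
    refine Finset.sum_congr rfl fun b _ => ?_
    simp only [superposition, of_apply, transpose_apply]
    ring
  simp only [htr, Complex.ofReal_re]
  simp only [hsq, Fintype.sum_prod_type, Pi.sub_apply, hrow]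
  simp [Fintype.sum_sum_type, entries, Fintype.sum_prod_type]

/-- The family of states with the two players exchanged. -/
def swapFamily (φ : I → I → EuclideanSpace ℂ (α × β)) : I → I → EuclideanSpace ℂ (β × α) :=
  fun y x => WithLp.toLp 2 fun i => φ x y (i.2, i.1)

omit [DecidableEq I] [DecidableEq α] [DecidableEq β] [Fintype I] in
lemma norm_swapFamily (φ : I → I → EuclideanSpace ℂ (α × β)) (x y : I) :
    ‖swapFamily φ y x‖ = ‖φ x y‖ := by
  rw [← sq_eq_sq₀ (norm_nonneg _) (norm_nonneg _), ← hsq_eq_norm, ← hsq_eq_norm]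
  simp only [hsq, swapFamily, Fintype.sum_prod_type]
  exact Finset.sum_comm

omit [DecidableEq α] [Fintype β] [DecidableEq β] in
lemma traceA_sigmaB (p : I → I → ℝ) (φ : I → I → EuclideanSpace ℂ (α × β)) (x x' y y' : I)
    (b b' : β) :
    traceA (sigmaB p φ) (x, (b, y)) (x', (b', y'))
      = traceB (sigmaA (fun y x => p x y) (swapFamily φ)) ((y, b), x) ((y', b'), x') := by
  simp only [traceA, traceB, of_apply, sigmaA, sigmaB, Matrix.sum_apply, Matrix.smul_apply,
    kroneckerMap_apply, ketbra, vecMulVec_apply, ketLA, ketLB, swapFamily, smul_eq_mul,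
    Pi.star_apply]
  refine Finset.sum_congr rfl fun a _ => Finset.sum_congr rfl fun z _ => ?_
  ring

-- Exchanging the players only permutes tensor factors, which changes no entropy, so the bound for
-- one side gives the other.
omit [DecidableEq α] in
lemma mutualInfo_traceA_sigmaB (p : I → I → ℝ) (φ : I → I → EuclideanSpace ℂ (α × β))
    (hp : ∀ x y, 0 ≤ p x y) :
    mutualInfo (traceA (sigmaB p φ))
      = mutualInfo (traceB (sigmaA (fun y x => p x y) (swapFamily φ))) := by
  set K := traceB (sigmaA (fun y x => p x y) (swapFamily φ)) with hK
  have hKR : K = _ := traceB_sigmaA (fun y x => p x y) (swapFamily φ) fun y x => hp x y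
  have hherm : ∀ x, (superposition (fun y x => p x y) (swapFamily φ) x *
      (superposition (fun y x => p x y) (swapFamily φ) x)ᴴ).IsHermitian := fun x =>
    isHermitian_mul_conjTranspose_self _
  have hK1 : K.IsHermitian := by
    rw [hKR, IsHermitian, blockDiagonal_conjTranspose]
    simp only [(hherm _).eq]
  have hK2 : (traceRight K).IsHermitian := by
    ext i j
    simp only [conjTranspose_apply, traceRight, of_apply, star_sum]
    exact Finset.sum_congr rfl fun y _ => hK1.apply _ _
  let e : (I × β) × I ≃ I × (β × I) :=
    ⟨fun i => (i.2, (i.1.2, i.1.1)), fun i => ((i.2.2, i.2.1), i.1), fun _ => rfl, fun _ => rfl⟩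
  have h1 : traceA (sigmaB p φ) = reindex e e K := by
    ext ⟨x, b, y⟩ ⟨x', b', y'⟩
    exact traceA_sigmaB p φ x x' y y' b b'
  have h2 : traceLeft (traceA (sigmaB p φ)) = reindex (Equiv.prodComm I β) (Equiv.prodComm I β)
      (traceRight K) := by
    ext ⟨b, y⟩ ⟨b', y'⟩
    simp only [traceLeft, of_apply, traceA_sigmaB, reindex_apply, submatrix_apply, traceRight]
    rfl
  have h3 : traceRight (traceA (sigmaB p φ)) = traceLeft K := by
    ext x x'
    simp only [traceRight, traceLeft, of_apply, Fintype.sum_prod_type, traceA_sigmaB]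
    exact Finset.sum_comm
  rw [mutualInfo, mutualInfo, h2, h3, h1, entropy_reindex _ hK1, entropy_reindex _ hK2]
  ring

/-- If `I(X:BY)` is small then `A` can, knowing `x`, rotate the states `φ_{xy}` to vectors which
nearly do not depend on `x`. -/
lemma exists_isometry_left (p : I → I → ℝ) (φ : I → I → EuclideanSpace ℂ (α × β))
    (hp : ∀ x y, 0 ≤ p x y) (hp1 : ∑ x, ∑ y, p x y = 1) (hφ : ∀ x y, ‖φ x y‖ = 1) :
    ∃ (F : I → Matrix (α ⊕ (I × β)) α ℂ) (t : I → (α ⊕ (I × β)) × β → ℂ),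
      (∀ x, (F x)ᴴ * F x = 1) ∧ ∑ y, hsq (t y) = 1 ∧
      ∑ x, ∑ y, hsq (((√(p x y) : ℝ) : ℂ) • ((F x ⊗ₖ (1 : Matrix β β ℂ)) *ᵥ (φ x y).ofLp)
        - ((√(∑ z, p x z) : ℝ) : ℂ) • t y) ≤ Real.log 2 * mutualInfo (traceA (sigmaB p φ)) := by
  obtain ⟨F, s, hF, hs, hle⟩ := exists_isometry_right (fun y x => p x y) (swapFamily φ)
    (fun y x => hp x y) (by rw [Finset.sum_comm]; exact hp1)
    (fun y x => (norm_swapFamily φ x y).trans (hφ x y))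
  refine ⟨F, fun y i => s y (i.2, i.1), hF, ?_, ?_⟩
  · rw [← hs]
    refine Finset.sum_congr rfl fun y _ => ?_
    simp only [hsq, Fintype.sum_prod_type]
    exact Finset.sum_comm
  · rw [mutualInfo_traceA_sigmaB p φ hp]
    refine le_trans (le_of_eq ?_) hle
    rw [Finset.sum_comm]
    refine Finset.sum_congr rfl fun y _ => Finset.sum_congr rfl fun x _ => ?_
    simp only [hsq, Fintype.sum_prod_type, Pi.sub_apply, Pi.smul_apply, one_kronecker_mulVec,
      kronecker_one_mulVec, swapFamily]
    exact Finset.sum_comm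

end sides

/-! ### Averaging over inputs -/

section averaging

/-- Makes the cost of changing square-root weights linear in the total variation distance. -/
lemma sq_sqrt_sub_sqrt_le {a b : ℝ} (ha : 0 ≤ a) (hb : 0 ≤ b) : (√a - √b) ^ 2 ≤ |a - b| := by
  have h1 : a - b = (√a - √b) * (√a + √b) := by
    have := Real.mul_self_sqrt ha
    have := Real.mul_self_sqrt hb
    linarith
  rw [h1, abs_mul, ← sq_abs, sq]
  refine mul_le_mul_of_nonneg_left ?_ (abs_nonneg _)
  rw [abs_of_nonneg (add_nonneg (Real.sqrt_nonneg a) (Real.sqrt_nonneg b)), abs_le]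
  constructor <;> linarith [Real.sqrt_nonneg a, Real.sqrt_nonneg b]

variable {ι I : Type*} [Fintype ι] [Fintype I]

lemma hsq_add_three_le (u v w : ι → ℂ) :
    hsq (u + v + w) ≤ 3 * (hsq u + hsq v + hsq w) := by
  simp only [hsq, Finset.mul_sum, ← Finset.sum_add_distrib]
  refine Finset.sum_le_sum fun i _ => ?_
  have h := norm_add₃_le (a := u i) (b := v i) (c := w i)
  have h0 := norm_nonneg (u i + v i + w i)
  simp only [Pi.add_apply]
  nlinarith [sq_nonneg (‖u i‖ - ‖v i‖), sq_nonneg (‖u i‖ - ‖w i‖), sq_nonneg (‖v i‖ - ‖w i‖),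
    norm_nonneg (u i), norm_nonneg (v i), norm_nonneg (w i)]

/-- Passing from a nearly uniform distribution to the uniform one. -/
lemma exists_hsq_sub_le_of_near_uniform [Nonempty I] (p : I → I → ℝ) (hp : ∀ x y, 0 ≤ p x y)
    (v : I → I → ι → ℂ) (hv : ∀ x y, hsq (v x y) = 1) (s : I → ι → ℂ)
    (hs : ∑ x, hsq (s x) = 1) :
    ∃ a : I → ι → ℂ, ∑ x, ∑ y, hsq (v x y - a x) ≤ (Fintype.card I : ℝ) ^ 2 *
      (3 * (2 * ∑ x, ∑ y, |p x y - 1 / (Fintype.card I : ℝ) ^ 2| +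
        ∑ x, ∑ y, hsq (((√(p x y) : ℝ) : ℂ) • v x y - ((√(∑ z, p z y) : ℝ) : ℂ) • s x))) := by
  set k : ℝ := (Fintype.card I : ℝ) with hk
  have hk0 : 0 < k := by exact Nat.cast_pos.2 Fintype.card_pos
  set D := ∑ x, ∑ y, |p x y - 1 / k ^ 2| with hD
  set u : ℝ := 1 / k with hu
  have hu0 : 0 < u := by positivity
  have hu2 : √(1 / k ^ 2) = u := by
    rw [show 1 / k ^ 2 = u ^ 2 by rw [hu]; ring, Real.sqrt_sq hu0.le]
  -- For uniform `p` the weights are `√p(x,y) = u` and `√p(·y) = √u`, so dividing by `u` leaves `√u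
  -- / u`.
  refine ⟨fun x => ((√u / u : ℝ) : ℂ) • s x, ?_⟩
  have hpt : ∀ x y, hsq (v x y - ((√u / u : ℝ) : ℂ) • s x) ≤ k ^ 2 * (3 * (|p x y - 1 / k ^ 2| +
      hsq (((√(p x y) : ℝ) : ℂ) • v x y - ((√(∑ z, p z y) : ℝ) : ℂ) • s x) +
        |∑ z, p z y - u| * hsq (s x))) := fun x y => by
    have h1 : hsq ((u : ℂ) • (v x y - ((√u / u : ℝ) : ℂ) • s x))
        = u ^ 2 * hsq (v x y - ((√u / u : ℝ) : ℂ) • s x) := by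
      rw [hsq_smul, Complex.norm_real, Real.norm_eq_abs, sq_abs]
    have h2 : (u : ℂ) • (v x y - ((√u / u : ℝ) : ℂ) • s x) =
        ((u - √(p x y) : ℝ) : ℂ) • v x y +
        (((√(p x y) : ℝ) : ℂ) • v x y - ((√(∑ z, p z y) : ℝ) : ℂ) • s x) +
        ((√(∑ z, p z y) - √u : ℝ) : ℂ) • s x := by
      have h3 : (u : ℂ) • ((√u / u : ℝ) : ℂ) • s x = ((√u : ℝ) : ℂ) • s x := by
        rw [smul_smul, ← Complex.ofReal_mul, mul_div_cancel₀ _ hu0.ne']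
      rw [smul_sub, h3]
      push_cast
      rw [sub_smul, sub_smul]
      abel
    have h4 := hsq_add_three_le (((u - √(p x y) : ℝ) : ℂ) • v x y)
      (((√(p x y) : ℝ) : ℂ) • v x y - ((√(∑ z, p z y) : ℝ) : ℂ) • s x)
      (((√(∑ z, p z y) - √u : ℝ) : ℂ) • s x)
    rw [← h2, h1, hsq_smul, hsq_smul, Complex.norm_real, Complex.norm_real, Real.norm_eq_abs,
      Real.norm_eq_abs, sq_abs, sq_abs, hv, mul_one] at h4
    have h5 : (u - √(p x y)) ^ 2 ≤ |p x y - 1 / k ^ 2| := by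
      rw [abs_sub_comm, ← hu2]
      exact sq_sqrt_sub_sqrt_le (by positivity) (hp x y)
    have h6 : (√(∑ z, p z y) - √u) ^ 2 * hsq (s x) ≤ |∑ z, p z y - u| * hsq (s x) :=
      mul_le_mul_of_nonneg_right
        (sq_sqrt_sub_sqrt_le (Finset.sum_nonneg fun z _ => hp z y) hu0.le) (hsq_nonneg _)
    have h7 : k ^ 2 * (u ^ 2 * hsq (v x y - ((√u / u : ℝ) : ℂ) • s x))
        = hsq (v x y - ((√u / u : ℝ) : ℂ) • s x) := by
      rw [← mul_assoc, hu]
      field_simp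
    rw [← h7]
    exact mul_le_mul_of_nonneg_left (h4.trans (by linarith)) (by positivity)
  refine (Finset.sum_le_sum fun x _ => Finset.sum_le_sum fun y _ => hpt x y).trans ?_
  simp only [← Finset.mul_sum, Finset.sum_add_distrib]
  refine mul_le_mul_of_nonneg_left ?_ (by positivity)
  have h8 : ∑ x, ∑ y, |∑ z, p z y - u| * hsq (s x) ≤ D := by
    simp only [← Finset.sum_mul, ← Finset.mul_sum, hs, mul_one]
    rw [hD, Finset.sum_comm]
    refine Finset.sum_le_sum fun y _ => ?_
    have h9 : ∑ z, p z y - u = ∑ z, (p z y - 1 / k ^ 2) := by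
      rw [Finset.sum_sub_distrib, Finset.sum_const, Finset.card_univ, nsmul_eq_mul, ← hk, hu]
      field_simp
    rw [h9]
    exact Finset.abs_sum_le_sum_abs _ _
  linarith

/-- A family of vectors which on average nearly does not depend on either of its two indices nearly
is constant. -/
lemma exists_hsq_sub_le_of_near_both [Nonempty I] (Φ : I → I → ι → ℂ) (a b : I → ι → ℂ)
    {δ₁ δ₂ : ℝ} (h₁ : ∑ x, ∑ y, hsq (Φ x y - a x) ≤ (Fintype.card I : ℝ) ^ 2 * δ₁)
    (h₂ : ∑ x, ∑ y, hsq (Φ x y - b y) ≤ (Fintype.card I : ℝ) ^ 2 * δ₂) :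
    ∃ x₀ y₀, ∑ x, ∑ y, hsq (Φ x₀ y₀ - Φ x y) ≤ (Fintype.card I : ℝ) ^ 2 * (8 * (δ₁ + δ₂)) := by
  set k : ℝ := (Fintype.card I : ℝ) with hk
  -- Path `Φ x₀ y₀ → b y₀ → Φ x y₀ → a x → Φ x y`. Averaged over all four indices, each step is a
  -- uniform average of one of the two hypotheses.
  have hpt : ∀ x₀ y₀ x y, hsq (Φ x₀ y₀ - Φ x y) ≤ 4 * hsq (Φ x₀ y₀ - b y₀) +
      4 * hsq (Φ x y₀ - b y₀) + 4 * hsq (Φ x y₀ - a x) + 4 * hsq (Φ x y - a x) := by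
    intro x₀ y₀ x y
    have e1 := hsq_add_le ((Φ x₀ y₀ - b y₀) + (b y₀ - Φ x y₀)) ((Φ x y₀ - a x) + (a x - Φ x y))
    have e2 := hsq_add_le (Φ x₀ y₀ - b y₀) (b y₀ - Φ x y₀)
    have e3 := hsq_add_le (Φ x y₀ - a x) (a x - Φ x y)
    rw [hsq_sub_comm (b y₀)] at e2
    rw [hsq_sub_comm (a x)] at e3
    rw [show (Φ x₀ y₀ - b y₀) + (b y₀ - Φ x y₀) + ((Φ x y₀ - a x) + (a x - Φ x y))
      = Φ x₀ y₀ - Φ x y by abel] at e1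
    linarith
  have hsum : ∑ z : I × I, ∑ x, ∑ y, hsq (Φ z.1 z.2 - Φ x y)
      ≤ ∑ _z : I × I, k ^ 2 * (8 * (δ₁ + δ₂)) := by
    rw [Fintype.sum_prod_type]
    refine (Finset.sum_le_sum fun x₀ _ => Finset.sum_le_sum fun y₀ _ => Finset.sum_le_sum fun x _ =>
      Finset.sum_le_sum fun y _ => hpt x₀ y₀ x y).trans ?_
    simp only [Finset.sum_add_distrib, ← Finset.mul_sum, Finset.sum_const, Finset.card_univ,
      nsmul_eq_mul, ← hk, Fintype.card_prod]
    have h₂' : ∑ y, ∑ x, hsq (Φ x y - b y) ≤ k ^ 2 * δ₂ := by rw [Finset.sum_comm]; exact h₂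
    have h₁' : ∑ y, ∑ x, hsq (Φ x y - a x) ≤ k ^ 2 * δ₁ := by rw [Finset.sum_comm]; exact h₁
    push_cast
    rw [← hk]
    have hk2 : 0 ≤ k * k := mul_self_nonneg k
    have g1 := mul_le_mul_of_nonneg_left h₁ hk2
    have g2 := mul_le_mul_of_nonneg_left h₂ hk2
    have g3 := mul_le_mul_of_nonneg_left h₁' hk2
    have g4 := mul_le_mul_of_nonneg_left h₂' hk2
    linarith
  obtain ⟨z, -, hz⟩ := Finset.exists_le_of_sum_le Finset.univ_nonempty hsum
  exact ⟨z.1, z.2, hz⟩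

end averaging

/-! ### Losing probabilities -/

section loss

variable {O α β α' β' : Type*} [Fintype O] [Fintype α] [DecidableEq α] [Fintype β] [DecidableEq β]
  [Fintype α'] [DecidableEq α'] [Fintype β'] [DecidableEq β']

/-- The probability that a product measurement of the state `ψ` yields an outcome rejected by
`V`. -/
noncomputable def lossProb (V : O → O → Bool) (A : Measurement O α) (B : Measurement O β)
    (ψ : α × β → ℂ) : ℝ :=
  ∑ a, ∑ b, (if V a b then 0 else 1) * (star ψ ⬝ᵥ ((A.op a ⊗ₖ B.op b) *ᵥ ψ)).re

omit [DecidableEq α] in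
lemma quadForm_nonneg {M : Matrix α α ℂ} (hM : M.PosSemidef) (v : α → ℂ) :
    0 ≤ (star v ⬝ᵥ (M *ᵥ v)).re :=
  (Complex.le_def.1 (hM.dotProduct_mulVec_nonneg v)).1

omit [DecidableEq α] in
lemma quadForm_add_le {M : Matrix α α ℂ} (hM : M.PosSemidef) (u v : α → ℂ) :
    (star (u + v) ⬝ᵥ (M *ᵥ (u + v))).re
      ≤ 2 * (star u ⬝ᵥ (M *ᵥ u)).re + 2 * (star v ⬝ᵥ (M *ᵥ v)).re := by
  have h := quadForm_nonneg hM (u - v)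
  simp only [mulVec_add, mulVec_sub, star_add, star_sub, add_dotProduct, sub_dotProduct,
    dotProduct_add, dotProduct_sub, Complex.add_re, Complex.sub_re] at h ⊢
  linarith

lemma Measurement.quadForm_kronecker_nonneg (A : Measurement O α) (B : Measurement O β) (a b : O)
    (ψ : α × β → ℂ) : 0 ≤ (star ψ ⬝ᵥ ((A.op a ⊗ₖ B.op b) *ᵥ ψ)).re :=
  quadForm_nonneg ((A.posSemidef a).kronecker (B.posSemidef b)) ψ

lemma sum_quadForm (A : Measurement O α) (B : Measurement O β) (ψ : α × β → ℂ) :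
    ∑ a, ∑ b, (star ψ ⬝ᵥ ((A.op a ⊗ₖ B.op b) *ᵥ ψ)).re = hsq ψ := by
  have h : ∑ a, ∑ b, A.op a ⊗ₖ B.op b = 1 := by
    have : ∑ a, ∑ b, A.op a ⊗ₖ B.op b = (∑ a, A.op a) ⊗ₖ (∑ b, B.op b) := by
      ext i j
      simp only [Matrix.sum_apply, kroneckerMap_apply, Finset.sum_mul_sum]
    rw [this, A.sum_eq_one, B.sum_eq_one, one_kronecker_one]
  have h2 : (hsq ψ : ℂ) = ∑ a, ∑ b, star ψ ⬝ᵥ ((A.op a ⊗ₖ B.op b) *ᵥ ψ) := by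
    rw [hsq_eq_dotProduct]
    conv_lhs => enter [2]; rw [← one_mulVec ψ, ← h]
    simp only [sum_mulVec, dotProduct_sum]
  have h3 := congrArg Complex.re h2
  simpa using h3.symm

lemma lossProb_nonneg (V : O → O → Bool) (A : Measurement O α) (B : Measurement O β)
    (ψ : α × β → ℂ) : 0 ≤ lossProb V A B ψ :=
  Finset.sum_nonneg fun a _ => Finset.sum_nonneg fun b _ =>
    mul_nonneg (by split_ifs <;> simp) (A.quadForm_kronecker_nonneg B a b ψ)

lemma lossProb_le_hsq (V : O → O → Bool) (A : Measurement O α) (B : Measurement O β)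
    (ψ : α × β → ℂ) : lossProb V A B ψ ≤ hsq ψ := by
  rw [← sum_quadForm A B]
  refine Finset.sum_le_sum fun a _ => Finset.sum_le_sum fun b _ => ?_
  have := A.quadForm_kronecker_nonneg B a b ψ
  split_ifs <;> simp [this]

/-- Positivity of the form at `u - v` gives the factor 2. Such a factor is affordable for the small
losing probability, not for the winning one, and it makes the error quadratic in `‖v‖`. -/
lemma lossProb_add_le (V : O → O → Bool) (A : Measurement O α) (B : Measurement O β)
    (u v : α × β → ℂ) :
    lossProb V A B (u + v) ≤ 2 * lossProb V A B u + 2 * lossProb V A B v := by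
  simp only [lossProb, Finset.mul_sum, ← Finset.sum_add_distrib]
  refine Finset.sum_le_sum fun a _ => Finset.sum_le_sum fun b _ => ?_
  have := quadForm_add_le ((A.posSemidef a).kronecker (B.posSemidef b)) u v
  split_ifs
  · simp
  · linarith

lemma winProb_eq_sum_lossProb {I : Type*} [Fintype I] (G : EntangledGame I O)
    (φ : I → I → EuclideanSpace ℂ (α × β)) (A : I → Measurement O α) (B : I → Measurement O β)
    (hφ : ∀ x y, ‖φ x y‖ = 1) :
    winProb G φ A B
      = 1 - ∑ x, ∑ y, G.p x y * lossProb (fun a b => G.V a b x y) (A x) (B y) (φ x y).ofLp := by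
  rw [eq_sub_iff_add_eq, ← G.p_sum, winProb, ← Finset.sum_add_distrib]
  refine Finset.sum_congr rfl fun x _ => ?_
  rw [← Finset.sum_add_distrib]
  refine Finset.sum_congr rfl fun y _ => ?_
  have h := sum_quadForm (A x) (B y) (φ x y).ofLp
  rw [hsq_eq_norm, hφ, one_pow] at h
  simp only [lossProb, Finset.mul_sum, ← Finset.sum_add_distrib]
  conv_rhs => rw [← mul_one (G.p x y), ← h]
  simp only [Finset.mul_sum]
  refine Finset.sum_congr rfl fun a _ => Finset.sum_congr rfl fun b _ => ?_
  split_ifs <;> ring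

open Classical in
/-- Transport of a measurement along an isometry; outside the range of the isometry the outcome is
`a₀`. -/
noncomputable def Measurement.transport (A : Measurement O α) (F : Matrix α' α ℂ)
    (hF : Fᴴ * F = 1) (a₀ : O) : Measurement O α' where
  op a := F * A.op a * Fᴴ + if a = a₀ then 1 - F * Fᴴ else 0
  posSemidef a := by
    refine ((A.posSemidef a).mul_mul_conjTranspose_same F).add ?_
    split_ifs
    · have h : (1 - F * Fᴴ) = (1 - F * Fᴴ) * (1 - F * Fᴴ)ᴴ := by
        have h2 : F * Fᴴ * (F * Fᴴ) = F * Fᴴ := by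
          calc _ = F * (Fᴴ * F) * Fᴴ := by simp only [Matrix.mul_assoc]
            _ = _ := by rw [hF, Matrix.mul_one]
        rw [conjTranspose_sub, conjTranspose_mul, conjTranspose_conjTranspose, conjTranspose_one,
          Matrix.sub_mul, Matrix.mul_sub, Matrix.mul_sub, h2]
        simp
      rw [h]
      exact posSemidef_self_mul_conjTranspose _
    · exact PosSemidef.zero
  sum_eq_one := by
    rw [Finset.sum_add_distrib, ← Matrix.sum_mul, ← Matrix.mul_sum, A.sum_eq_one]
    simp

/-- Compressing to the range of `F` kills the correction `1 - F Fᴴ`, so the choice of `a₀` does not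
affect the statistics of transported states. -/
lemma Measurement.conj_transport (A : Measurement O α) (F : Matrix α' α ℂ) (hF : Fᴴ * F = 1)
    (a₀ a : O) : Fᴴ * (A.transport F hF a₀).op a * F = A.op a := by
  have h1 : Fᴴ * (F * A.op a * Fᴴ) * F = A.op a := by
    calc _ = (Fᴴ * F) * A.op a * (Fᴴ * F) := by simp only [Matrix.mul_assoc]
      _ = _ := by rw [hF]; simp
  have h2 : Fᴴ * (1 - F * Fᴴ) * F = 0 := by
    calc _ = Fᴴ * F - (Fᴴ * F) * (Fᴴ * F) := by
          simp only [Matrix.mul_assoc, Matrix.mul_sub, Matrix.sub_mul, Matrix.one_mul]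
      _ = _ := by rw [hF]; simp
  simp only [Measurement.transport, Matrix.mul_add, Matrix.add_mul, h1]
  split_ifs <;> simp [h2]

lemma lossProb_transport (V : O → O → Bool) (A : Measurement O α) (B : Measurement O β)
    (F : Matrix α' α ℂ) (hF : Fᴴ * F = 1) (E : Matrix β' β ℂ) (hE : Eᴴ * E = 1) (a₀ : O)
    (ψ : α × β → ℂ) :
    lossProb V (A.transport F hF a₀) (B.transport E hE a₀) ((F ⊗ₖ E) *ᵥ ψ)
      = lossProb V A B ψ := by
  have h : ∀ a b, star ((F ⊗ₖ E) *ᵥ ψ) ⬝ᵥ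
      (((A.transport F hF a₀).op a ⊗ₖ (B.transport E hE a₀).op b) *ᵥ ((F ⊗ₖ E) *ᵥ ψ))
      = star ψ ⬝ᵥ ((A.op a ⊗ₖ B.op b) *ᵥ ψ) := fun a b => by
    rw [star_mulVec, ← dotProduct_mulVec, mulVec_mulVec, mulVec_mulVec, conjTranspose_kronecker,
      ← mul_kronecker_mul, ← mul_kronecker_mul,
      A.conj_transport, B.conj_transport]
  simp only [lossProb, h]

omit [Fintype α] [Fintype β] [DecidableEq α'] [DecidableEq β'] in
lemma isometry_kronecker (F : Matrix α' α ℂ) (hF : Fᴴ * F = 1) (E : Matrix β' β ℂ)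
    (hE : Eᴴ * E = 1) : (F ⊗ₖ E)ᴴ * (F ⊗ₖ E) = 1 := by
  rw [conjTranspose_kronecker, ← mul_kronecker_mul, hF, hE, one_kronecker_one]

end loss

/-! ### The entangled value -/

section value

variable {I O α β : Type*} [Fintype I] [Fintype O]
  [Fintype α] [DecidableEq α] [Fintype β] [DecidableEq β]

lemma winProb_le_one (G : EntangledGame I O) (φ : I → I → EuclideanSpace ℂ (α × β))
    (A : I → Measurement O α) (B : I → Measurement O β) (hφ : ∀ x y, ‖φ x y‖ = 1) :
    winProb G φ A B ≤ 1 := by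
  rw [winProb_eq_sum_lossProb G φ A B hφ, sub_le_self_iff]
  exact Finset.sum_nonneg fun x _ => Finset.sum_nonneg fun y _ =>
    mul_nonneg (G.p_nonneg x y) (lossProb_nonneg _ _ _ _)

lemma winProb_nonneg (G : EntangledGame I O) (φ : I → I → EuclideanSpace ℂ (α × β))
    (A : I → Measurement O α) (B : I → Measurement O β) : 0 ≤ winProb G φ A B :=
  Finset.sum_nonneg fun x _ => Finset.sum_nonneg fun y _ => Finset.sum_nonneg fun a _ =>
    Finset.sum_nonneg fun b _ => mul_nonneg
      (mul_nonneg (G.p_nonneg x y) (by split_ifs <;> simp))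
      ((A x).quadForm_kronecker_nonneg (B y) a b _)

lemma entangledValue_nonneg (G : EntangledGame I O) : 0 ≤ entangledValue G := by
  refine Real.sSup_nonneg ?_
  rintro _ ⟨m, n, ψ, A, B, -, rfl⟩
  exact winProb_nonneg _ _ _ _

lemma exists_isometry_fin (α : Type*) [Fintype α] [DecidableEq α] :
    ∃ F : Matrix (Fin (Fintype.card α)) α ℂ, Fᴴ * F = 1 := by
  refine ⟨(1 : Matrix α α ℂ).submatrix (Fintype.equivFin α).symm id, ?_⟩
  rw [conjTranspose_submatrix, submatrix_mul_equiv]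
  simp

/-- The supremum only ranges over `Fin m` and `Fin n`; strategies on other index types are
transported there. -/
lemma winProb_le_entangledValue [Nonempty O] (G : EntangledGame I O)
    (ψ : EuclideanSpace ℂ (α × β)) (hψ : ‖ψ‖ = 1) (A : I → Measurement O α)
    (B : I → Measurement O β) : winProb G (fun _ _ => ψ) A B ≤ entangledValue G := by
  obtain ⟨F, hF⟩ := exists_isometry_fin α
  obtain ⟨E, hE⟩ := exists_isometry_fin β
  let a₀ : O := Classical.arbitrary O
  set ψ' : EuclideanSpace ℂ (Fin (Fintype.card α) × Fin (Fintype.card β)) :=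
    WithLp.toLp 2 ((F ⊗ₖ E) *ᵥ ψ.ofLp) with hψ'
  have h1 : ‖ψ'‖ = 1 := by
    rw [← sq_eq_sq₀ (norm_nonneg _) zero_le_one, ← hsq_eq_norm, hψ',
      hsq_mulVec_of_isometry _ (isometry_kronecker F hF E hE), hsq_eq_norm, hψ]
  refine le_csSup ⟨1, ?_⟩ ⟨Fintype.card α, Fintype.card β, ψ', fun x => (A x).transport F hF a₀,
    fun y => (B y).transport E hE a₀, h1, ?_⟩
  · rintro _ ⟨m, n, ψ, A, B, hψ, rfl⟩
    exact winProb_le_one _ _ _ _ fun _ _ => hψ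
  · rw [winProb_eq_sum_lossProb _ _ _ _ fun _ _ => hψ,
      winProb_eq_sum_lossProb _ _ _ _ fun _ _ => h1]
    simp only [hψ', lossProb_transport]

end value

/-! ### Removing the advice from a strategy -/

section main

variable {O α β : Type*} [Fintype O] [Fintype α] [DecidableEq α] [Fintype β] [DecidableEq β]

/-- Strategies with advice yield strategies without advice, at a loss linear in the superposed
information cost of the advice. -/
theorem one_sub_entangledValue_le [Nonempty O] {k : ℕ} (G G' : EntangledGame (Fin k) O)
    (hG : G.IsUniform) (hV : G'.V = G.V) (φ : Fin k → Fin k → EuclideanSpace ℂ (α × β))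
    (hφ : ∀ x y, ‖φ x y‖ = 1) (A : Fin k → Measurement O α) (B : Fin k → Measurement O β) :
    1 - entangledValue G ≤ 2 * (1 - winProb G' φ A B)
      + 194 * ∑ x, ∑ y, |G'.p x y - 1 / (k : ℝ) ^ 2| + 48 * sicFamily G'.p φ := by
  have hI : Nonempty (Fin k) := by
    by_contra h
    rw [not_nonempty_iff] at h
    have := G.p_sum
    simp at this
  have hk0 : (0 : ℝ) < k := by
    have := Fintype.card_pos (α := Fin k)
    rw [Fintype.card_fin] at this
    exact_mod_cast this
  set D := ∑ x, ∑ y, |G'.p x y - 1 / (k : ℝ) ^ 2| with hD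
  have hsq1 : ∀ x y, hsq (φ x y).ofLp = 1 := fun x y => by rw [hsq_eq_norm, hφ, one_pow]
  obtain ⟨E, s, hE, hs, hEs⟩ := exists_isometry_right G'.p φ G'.p_nonneg G'.p_sum hφ
  obtain ⟨F, t, hF, ht, hFt⟩ := exists_isometry_left G'.p φ G'.p_nonneg G'.p_sum hφ
  have hE1 : ∀ y, ((1 : Matrix α α ℂ) ⊗ₖ E y)ᴴ * ((1 : Matrix α α ℂ) ⊗ₖ E y) = 1 := fun y =>
    isometry_kronecker 1 (by simp) (E y) (hE y)
  have hF1 : ∀ x, (F x ⊗ₖ (1 : Matrix β β ℂ))ᴴ * (F x ⊗ₖ (1 : Matrix β β ℂ)) = 1 := fun x =>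
    isometry_kronecker (F x) (hF x) 1 (by simp)
  -- `log 2 ≤ 1` may be dropped because `0 ≤ S` forces `0 ≤ J`.
  have hlog : ∀ {S J : ℝ}, 0 ≤ S → S ≤ Real.log 2 * J → S ≤ J := fun {S J} h0 h => by
    have h2 := Real.log_pos one_lt_two
    have h3 : Real.log 2 ≤ 1 := by linarith [Real.log_le_sub_one_of_pos (x := 2) (by norm_num)]
    have h4 : 0 ≤ J := by
      by_contra hJ
      nlinarith
    nlinarith
  obtain ⟨a, ha⟩ := exists_hsq_sub_le_of_near_uniform G'.p G'.p_nonneg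
    (fun x y => ((1 : Matrix α α ℂ) ⊗ₖ E y) *ᵥ (φ x y).ofLp)
    (fun x y => by rw [hsq_mulVec_of_isometry _ (hE1 y), hsq1]) s hs
  obtain ⟨b, hb⟩ := exists_hsq_sub_le_of_near_uniform (fun y x => G'.p x y)
    (fun y x => G'.p_nonneg x y) (fun y x => (F x ⊗ₖ (1 : Matrix β β ℂ)) *ᵥ (φ x y).ofLp)
    (fun y x => by rw [hsq_mulVec_of_isometry _ (hF1 x), hsq1]) t ht
  rw [Fintype.card_fin] at ha hb
  have hJ1 := hlog (Finset.sum_nonneg fun x _ => Finset.sum_nonneg fun y _ => hsq_nonneg _) hEs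
  have hJ2 := hlog (Finset.sum_nonneg fun x _ => Finset.sum_nonneg fun y _ => hsq_nonneg _) hFt
  set J₁ := mutualInfo (traceB (sigmaA G'.p φ))
  set J₂ := mutualInfo (traceA (sigmaB G'.p φ))
  have hk2 : (0 : ℝ) < (k : ℝ) ^ 2 := by positivity
  replace ha := ha.trans (mul_le_mul_of_nonneg_left (mul_le_mul_of_nonneg_left
    (add_le_add_right hJ1 (2 * D)) (by norm_num : (0 : ℝ) ≤ 3)) hk2.le)
  rw [Finset.sum_comm] at hb
  have hb' : ∑ y, ∑ x, |G'.p x y - 1 / (k : ℝ) ^ 2| = D := Finset.sum_comm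
  rw [hb', Finset.sum_comm (f := fun y x => hsq (((√(G'.p x y) : ℝ) : ℂ) •
    ((F x ⊗ₖ (1 : Matrix β β ℂ)) *ᵥ (φ x y).ofLp) - ((√(∑ z, G'.p x z) : ℝ) : ℂ) • t y))] at hb
  replace hb := hb.trans (mul_le_mul_of_nonneg_left (mul_le_mul_of_nonneg_left
    (add_le_add_right hJ2 (2 * D)) (by norm_num : (0 : ℝ) ≤ 3)) hk2.le)
  -- The two local isometries commute. Applying the remaining one preserves distances, and `F x`
  -- keeps `a x` a function of `x` alone, just as `E y` keeps `b y` one of `y`.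
  have hΦ1 : ∀ x y, (F x ⊗ₖ E y) *ᵥ (φ x y).ofLp
      = (F x ⊗ₖ (1 : Matrix _ _ ℂ)) *ᵥ (((1 : Matrix α α ℂ) ⊗ₖ E y) *ᵥ (φ x y).ofLp) :=
    fun x y => by rw [mulVec_mulVec, ← mul_kronecker_mul, Matrix.mul_one, Matrix.one_mul]
  have hΦ2 : ∀ x y, (F x ⊗ₖ E y) *ᵥ (φ x y).ofLp
      = ((1 : Matrix _ _ ℂ) ⊗ₖ E y) *ᵥ ((F x ⊗ₖ (1 : Matrix β β ℂ)) *ᵥ (φ x y).ofLp) :=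
    fun x y => by rw [mulVec_mulVec, ← mul_kronecker_mul, Matrix.mul_one, Matrix.one_mul]
  obtain ⟨x₀, y₀, h₀⟩ := exists_hsq_sub_le_of_near_both
    (fun x y => (F x ⊗ₖ E y) *ᵥ (φ x y).ofLp)
    (fun x => (F x ⊗ₖ (1 : Matrix _ _ ℂ)) *ᵥ a x) (fun y => ((1 : Matrix _ _ ℂ) ⊗ₖ E y) *ᵥ b y)
    (δ₁ := 3 * (2 * D + J₁)) (δ₂ := 3 * (2 * D + J₂))
    (by
      rw [Fintype.card_fin]
      refine le_trans (le_of_eq ?_) ha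
      refine Finset.sum_congr rfl fun x _ => Finset.sum_congr rfl fun y _ => ?_
      rw [hΦ1, ← mulVec_sub, hsq_mulVec_of_isometry _
        (isometry_kronecker (F x) (hF x) 1 (by simp))])
    (by
      rw [Fintype.card_fin]
      refine le_trans (le_of_eq ?_) hb
      refine Finset.sum_congr rfl fun x _ => Finset.sum_congr rfl fun y _ => ?_
      rw [hΦ2, ← mulVec_sub, hsq_mulVec_of_isometry _
        (isometry_kronecker 1 (by simp) (E y) (hE y))])
  rw [Fintype.card_fin] at h₀
  let a₀ : O := Classical.arbitrary O
  set ψ : EuclideanSpace ℂ ((α ⊕ (Fin k × β)) × (β ⊕ (Fin k × α))) :=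
    WithLp.toLp 2 ((F x₀ ⊗ₖ E y₀) *ᵥ (φ x₀ y₀).ofLp) with hψ
  have hψ1 : ‖ψ‖ = 1 := by
    rw [← sq_eq_sq₀ (norm_nonneg _) zero_le_one, ← hsq_eq_norm, hψ,
      hsq_mulVec_of_isometry _ (isometry_kronecker _ (hF x₀) _ (hE y₀)), hsq1, one_pow]
  have hval := winProb_le_entangledValue G ψ hψ1 (fun x => (A x).transport (F x) (hF x) a₀)
    (fun y => (B y).transport (E y) (hE y) a₀)
  rw [winProb_eq_sum_lossProb _ _ _ _ fun _ _ => hψ1] at hval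
  rw [winProb_eq_sum_lossProb _ _ _ _ hφ, hV]
  set ℓ : Fin k → Fin k → ℝ := fun x y =>
    lossProb (fun a b => G.V a b x y) (A x) (B y) (φ x y).ofLp with hℓ
  have hpt : ∀ x y, G.p x y * lossProb (fun a b => G.V a b x y)
      ((A x).transport (F x) (hF x) a₀) ((B y).transport (E y) (hE y) a₀) ψ.ofLp ≤
      2 * (G'.p x y * ℓ x y) + 2 * |G'.p x y - 1 / (k : ℝ) ^ 2| + (2 / (k : ℝ) ^ 2) *
        hsq ((F x₀ ⊗ₖ E y₀) *ᵥ (φ x₀ y₀).ofLp - (F x ⊗ₖ E y) *ᵥ (φ x y).ofLp) := by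
    intro x y
    have e1 := lossProb_add_le (fun a b => G.V a b x y)
      ((A x).transport (F x) (hF x) a₀) ((B y).transport (E y) (hE y) a₀)
      ((F x ⊗ₖ E y) *ᵥ (φ x y).ofLp)
      ((F x₀ ⊗ₖ E y₀) *ᵥ (φ x₀ y₀).ofLp - (F x ⊗ₖ E y) *ᵥ (φ x y).ofLp)
    rw [add_sub_cancel, lossProb_transport] at e1
    have e2 := lossProb_le_hsq (fun a b => G.V a b x y)
      ((A x).transport (F x) (hF x) a₀) ((B y).transport (E y) (hE y) a₀)
      ((F x₀ ⊗ₖ E y₀) *ᵥ (φ x₀ y₀).ofLp - (F x ⊗ₖ E y) *ᵥ (φ x y).ofLp)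
    have e3 : 0 ≤ ℓ x y := lossProb_nonneg _ _ _ _
    have e4 : ℓ x y ≤ 1 := (lossProb_le_hsq _ _ _ _).trans (hsq1 x y).le
    -- Since `ℓ ≤ 1`, changing the input weight costs at most its deviation; doubled and summed,
    -- this is the `2 * D` that brings 192 to 194.
    have e5 : 1 / (k : ℝ) ^ 2 * ℓ x y ≤ G'.p x y * ℓ x y + |G'.p x y - 1 / (k : ℝ) ^ 2| := by
      have := neg_le_abs (G'.p x y - 1 / (k : ℝ) ^ 2)
      have := abs_nonneg (G'.p x y - 1 / (k : ℝ) ^ 2)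
      nlinarith
    rw [hG x y]
    have e6 := mul_le_mul_of_nonneg_left (e1.trans (add_le_add_right
      (mul_le_mul_of_nonneg_left e2 (by norm_num : (0 : ℝ) ≤ 2)) _))
      (by positivity : (0 : ℝ) ≤ 1 / (k : ℝ) ^ 2)
    refine e6.trans ?_
    calc _ = 2 * (1 / (k : ℝ) ^ 2 * ℓ x y) + (2 / (k : ℝ) ^ 2) *
        hsq ((F x₀ ⊗ₖ E y₀) *ᵥ (φ x₀ y₀).ofLp - (F x ⊗ₖ E y) *ᵥ (φ x y).ofLp) := by
          simp only [hℓ]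
          ring
      _ ≤ _ := by linarith
  have hsum := Finset.sum_le_sum fun x (_ : x ∈ Finset.univ) =>
    Finset.sum_le_sum fun y (_ : y ∈ Finset.univ) => hpt x y
  simp only [Finset.sum_add_distrib, ← Finset.mul_sum] at hsum
  rw [← hD] at hsum
  have h₁ := mul_le_mul_of_nonneg_left h₀ (by positivity : (0 : ℝ) ≤ 2 / (k : ℝ) ^ 2)
  have h₂ : 2 / (k : ℝ) ^ 2 * ((k : ℝ) ^ 2 * (8 * (3 * (2 * D + J₁) + 3 * (2 * D + J₂))))
      = 192 * D + 48 * (J₁ + J₂) := by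
    field_simp
    ring
  rw [h₂] at h₁
  have h₃ : sicFamily G'.p φ = J₁ + J₂ := rfl
  rw [h₃]
  linarith

end main

/-! ### Representations of an advice state -/

section advice

variable {I O α β : Type*} [Fintype I] [DecidableEq I] [Fintype O]
  [Fintype α] [DecidableEq α] [Fintype β] [DecidableEq β]

omit [Fintype α] [DecidableEq α] [Fintype β] [DecidableEq β] in
lemma adviceState_apply (p : I → I → ℝ) (φ : I → I → EuclideanSpace ℂ (α × β)) (x y : I)
    (i j : α × β) :
    adviceState p φ ((x, i), y) ((x, j), y) = (p x y : ℂ) * (φ x y i * star (φ x y j)) := by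
  simp only [adviceState, Matrix.sum_apply, Matrix.smul_apply, kroneckerMap_apply, basisProj,
    ketbra, vecMulVec_apply, Pi.star_apply, Pi.single_apply, smul_eq_mul]
  rw [Finset.sum_eq_single x, Finset.sum_eq_single y]
  · simp
  · intro z _ hz
    simp [Ne.symm hz]
  · simp
  · intro z _ hz
    simp [Ne.symm hz]
  · simp

-- The trace of the block at `(x, y)` recovers `p x y`, so representations of a state differ only in
-- the vectors.
omit [DecidableEq α] [DecidableEq β] in
lemma eq_of_adviceState_eq {p p' : I → I → ℝ} {φ φ' : I → I → EuclideanSpace ℂ (α × β)}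
    (hφ : ∀ x y, ‖φ x y‖ = 1) (hφ' : ∀ x y, ‖φ' x y‖ = 1)
    (h : adviceState p φ = adviceState p' φ') : p = p' := by
  have key : ∀ (p : I → I → ℝ) (φ : I → I → EuclideanSpace ℂ (α × β)), (∀ x y, ‖φ x y‖ = 1) →
      ∀ x y, ∑ i, adviceState p φ ((x, i), y) ((x, i), y) = (p x y : ℂ) := fun p φ hφ x y => by
    simp only [adviceState_apply, ← Finset.mul_sum, RCLike.star_def, Complex.mul_conj']
    have h1 := hsq_eq_norm (φ x y)
    rw [hφ, hsq] at h1
    have h2 : ∑ i, ((‖φ x y i‖ : ℝ) : ℂ) ^ 2 = 1 := by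
      rw [one_pow] at h1
      exact_mod_cast h1
    rw [h2, mul_one]
  ext x y
  have := key p φ hφ x y
  rw [h, key p' φ' hφ'] at this
  exact_mod_cast this.symm

/-- Each term pairs an operator with the block `p(x,y) |φ_{xy}⟩⟨φ_{xy}|`, so phases, and vectors of
weight zero, do not matter. -/
lemma winProb_eq_of_adviceState_eq (G : EntangledGame I O)
    {φ φ' : I → I → EuclideanSpace ℂ (α × β)} (h : adviceState G.p φ = adviceState G.p φ')
    (A : I → Measurement O α) (B : I → Measurement O β) :
    winProb G φ A B = winProb G φ' A B := by
  have key : ∀ (φ : I → I → EuclideanSpace ℂ (α × β)) (x y : I) (M : Matrix (α × β) (α × β) ℂ),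
      G.p x y * (star (φ x y).ofLp ⬝ᵥ (M *ᵥ (φ x y).ofLp)).re
        = (∑ i, ∑ j, M i j * adviceState G.p φ ((x, j), y) ((x, i), y)).re := fun φ x y M => by
    rw [← Complex.re_ofReal_mul]
    congr 1
    simp only [adviceState_apply, dotProduct, mulVec, Finset.mul_sum, Pi.star_apply]
    refine Finset.sum_congr rfl fun i _ => Finset.sum_congr rfl fun j _ => ?_
    ring
  refine Finset.sum_congr rfl fun x _ => Finset.sum_congr rfl fun y _ => Finset.sum_congr rfl
    fun a _ => Finset.sum_congr rfl fun b _ => ?_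
  rw [mul_comm (G.p x y), mul_assoc, mul_assoc, key, key, h]

lemma adviceValue_eq_of_adviceState_eq (G : EntangledGame I O)
    {φ φ' : I → I → EuclideanSpace ℂ (α × β)} (h : adviceState G.p φ = adviceState G.p φ') :
    adviceValue G φ = adviceValue G φ' := by
  simp only [adviceValue, winProb_eq_of_adviceState_eq G h]

end advice

end EntangledGames

theorem theorem3 :
    ∃ c₀ : ℝ, 0 < c₀ ∧ ∃ c : ℝ, 0 < c ∧
      ∀ (k : ℕ) (O : Type*) [Fintype O] (G G' : EntangledGames.EntangledGame (Fin k) O) (ε : ℝ)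
        (α β : Type*) [Fintype α] [DecidableEq α] [Fintype β] [DecidableEq β]
        (φ : Fin k → Fin k → EuclideanSpace ℂ (α × β)),
        G.IsUniform →
        EntangledGames.entangledValue G = 1 - ε →
        G'.V = G.V →
        (1 / 2 : ℝ) * ∑ x, ∑ y, |G'.p x y - 1 / (k : ℝ) ^ 2| ≤ c₀ * ε →
        (∀ x y, ‖φ x y‖ = 1) →
        1 - ε / 4 ≤ EntangledGames.adviceValue G' φ →
        c * ε ≤ EntangledGames.sic (EntangledGames.adviceState G'.p φ) := by
  -- With `D ≤ 2 c₀ ε`, the value `c₀ = 1/1552` gives `194 D ≤ ε/4`. The advice loss contributes `2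
  -- · ε/4 = ε/2`, so `ε/4 ≤ 48 SIC` remains.
  refine ⟨1 / 1552, by norm_num, 1 / 192, by norm_num, ?_⟩
  intro k O _ G G' ε α β _ _ _ _ φ hG hval hV hTV hφ hadv
  have hε : ε ≤ 1 := by linarith [EntangledGames.entangledValue_nonneg G]
  refine le_csInf ⟨_, G'.p, φ, G'.p_nonneg, G'.p_sum, hφ, rfl, rfl⟩ ?_
  rintro _ ⟨p, φ', -, -, hφ', hρ, rfl⟩
  obtain rfl := EntangledGames.eq_of_adviceState_eq hφ' hφ hρ
  rw [← EntangledGames.adviceValue_eq_of_adviceState_eq G' hρ] at hadv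
  -- Without outcomes the advice value would be at most `0`, against `1 - ε/4 ≥ 3/4`.
  have hne : Nonempty O := by
    by_contra h
    rw [not_nonempty_iff] at h
    have : EntangledGames.adviceValue G' φ' ≤ 0 := by
      refine Real.sSup_le ?_ le_rfl
      rintro _ ⟨A, B, rfl⟩
      simp [EntangledGames.winProb]
    linarith
  -- The supremum over measurements is only approached, up to `τ`, so its attainment is not needed.
  have hlt : ∀ τ > 0, ε ≤ ε / 2 + 2 * τ + ε / 4 + 48 * EntangledGames.sicFamily G'.p φ' := by
    intro τ hτ
    have hset : {w | ∃ (A : Fin k → EntangledGames.Measurement O α)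
        (B : Fin k → EntangledGames.Measurement O β),
        w = EntangledGames.winProb G' φ' A B}.Nonempty := by
      by_contra h
      rw [Set.not_nonempty_iff_eq_empty] at h
      rw [EntangledGames.adviceValue, h, Real.sSup_empty] at hadv
      linarith
    obtain ⟨_, ⟨A, B, rfl⟩, hw⟩ := exists_lt_of_lt_csSup hset
      (lt_of_lt_of_le (sub_lt_self _ hτ) hadv)
    have := EntangledGames.one_sub_entangledValue_le G G' hG hV φ' hφ' A B
    linarith
  have := le_of_forall_pos_le_add (a := ε) (b := ε / 2 + ε / 4 + 48 *
    EntangledGames.sicFamily G'.p φ') fun τ hτ => by linarith [hlt (τ / 2) (by positivity)]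
  linarith
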